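/- **Theorem.** Let $\alpha,a,b,h>0$ and $j\in\{1,2\}$. Put $$m_1(k)=1+b|k|+ak^2,\qquad m_2(k)=1+bk\coth(hk)+ak^2\quad (m_2(0)=1+b/h),\qquad \varphi_j(k)=\frac{k}{m_j(k)},$$ and let $A_j$ be the Fourier multiplier $\widehat{A_j\psi}(k)=-\mathrm{i}\,\varphi_j(k)\,\widehat\psi(k)$. Let $s\ge 1$, and let $H^s$ be either the space of real-valued functions in the Sobolev space $H^s(\mathbb R)$, with $\|f\|_s^2=\int_{\mathbb R}(1+k^2)^s|\widehat f(k)|^2\,dk$, or the space of real-valued $2\pi$-periodic functions in $H^s_{\rm per}$, with $\|f\|_s^2=\sum_{k\in\mathbb Z}(1+k^2)^s|\widehat f(k)|^2$ (in this case $k\in\mathbb Z$ throughout). Then $F(\eta)=A_j\big(\eta-\tfrac{3\alpha}{4}\eta^2\big)$ is a well-defined continuous map $F:H^s\to H^s$, and for every $\eta_0\in H^s$ the Cauchy problem $$\eta_t=A_j\Big(\eta-\frac{3\alpha}{4}\eta^2\Big),\qquad \eta(0)=\eta_0,$$ is globally well-posed in $H^s$, that is, for every $T>0$: (a) there is $\eta\in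 C([-T,T];H^s)$ with $\eta(0)=\eta_0$ such that for every $t\in[-T,T]$ $$\lim_{\tau\to0}\Big\|\frac{\eta(t+\tau)-\eta(t)}{\tau}-F(\eta(t))\Big\|_s=0$$ (one-sided limits at $t=\pm T$); (b) there is at most one such $\eta$ in $C([-T,T];H^s)$; (c) if $\phi_n\to\phi^*$ in $H^s$ and $\eta^*\in C([-T,T];H^s)$ is a solution with $\eta^*(0)=\phi^*$, then for all sufficiently large $n$ there is a solution $\eta_n$ on $[-T,T]$ with $\eta_n(0)=\phi_n$, and $\sup_{t\in[-T,T]}\|\eta_n(t)-\eta^*(t)\|_s\to0$. In particular there is a unique $\eta\in C(\mathbb R;H^s)$ that solves the problem on all of $\mathbb R$. -/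

import Mathlib

open MeasureTheory Filter Topology
open scoped FourierTransform ENNReal

noncomputable section

namespace RegBenjamin

/-! ### Well-posedness of an autonomous Cauchy problem `η' = F η`, `η 0 = φ` -/

section WellPosed

variable {Y : Type*} [NormedAddCommGroup Y] [NormedSpace ℝ Y]

/-- `η ∈ C([-T,T]; Y)` with `η 0 = φ` and `η' = F η` on `[-T,T]`, the derivative being the limit of
difference quotients in `Y`, one-sided at the end points. Only the values of `η` on `[-T,T]`
matter. -/
structure IsSolutionOn (F : Y → Y) (φ : Y) (T : ℝ) (η : ℝ → Y) : Prop where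
  continuousOn : ContinuousOn η (Set.Icc (-T) T)
  init : η 0 = φ
  hasDeriv : ∀ t ∈ Set.Icc (-T) T, HasDerivWithinAt η (F (η t)) (Set.Icc (-T) T) t

/-- `η ∈ C(ℝ; Y)` with `η 0 = φ` and `η' = F η` on `ℝ`. -/
structure IsGlobalSolution (F : Y → Y) (φ : Y) (η : ℝ → Y) : Prop where
  continuous : Continuous η
  init : η 0 = φ
  hasDeriv : ∀ t, HasDerivAt η (F (η t)) t

/-- Well-posedness on the time interval `[-T,T]`: existence and uniqueness for the datum `φ`, and
continuous dependence on the data: if `φₙ → φ'` and `η'` is a solution on `[-T,T]` with datum `φ'`,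
then for `n` large there are solutions `ηₙ` on `[-T,T]` with data `φₙ`, and `ηₙ → η'` uniformly on
`[-T,T]`. -/
structure WellPosedOn (F : Y → Y) (φ : Y) (T : ℝ) : Prop where
  exists_solution : ∃ η, IsSolutionOn F φ T η
  unique : ∀ η₁ η₂, IsSolutionOn F φ T η₁ → IsSolutionOn F φ T η₂ →
    Set.EqOn η₁ η₂ (Set.Icc (-T) T)
  continuous_dependence : ∀ (φs : ℕ → Y) (φ' : Y) (η' : ℝ → Y),
    Tendsto φs atTop (𝓝 φ') → IsSolutionOn F φ' T η' →
    ∃ ηs : ℕ → ℝ → Y, (∀ᶠ n in atTop, IsSolutionOn F (φs n) T (ηs n)) ∧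
      TendstoUniformlyOn ηs η' atTop (Set.Icc (-T) T)

/-- Global well-posedness: well-posedness on `[-T,T]` for every `T > 0`, and a unique solution in
`C(ℝ; Y)`. -/
structure GloballyWellPosed (F : Y → Y) (φ : Y) : Prop where
  wellPosedOn : ∀ T : ℝ, 0 < T → WellPosedOn F φ T
  existsUnique : ∃! η : ℝ → Y, IsGlobalSolution F φ η

end WellPosed

/-! ### The symbols -/

/-- The two dispersive operators: the Hilbert transform on the line (or circle), and the Hilbert
transform on the strip of height `h`. -/
inductive Dispersion
  | hilbert
  | strip

/-- `1 + b|k| + a k²`, respectively `1 + b k coth(hk) + a k²` (with its limit `1 + b/h` at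
`k = 0`). -/
def symbolM (j : Dispersion) (a b h k : ℝ) : ℝ :=
  match j with
  | .hilbert => 1 + b * |k| + a * k ^ 2
  | .strip =>
      if k = 0 then 1 + b / h
      else 1 + b * k * (Real.cosh (h * k) / Real.sinh (h * k)) + a * k ^ 2

/-- `φ_j(k) = k / m_j(k)`. -/
def symbolPhi (j : Dispersion) (a b h k : ℝ) : ℝ := k / symbolM j a b h k

/-- The symbol `-i φ_j(k)` of the operator `A_j`. -/
def symbolA (j : Dispersion) (a b h k : ℝ) : ℂ := -Complex.I * (symbolPhi j a b h k : ℂ)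

lemma le_symbolM (j : Dispersion) {a b h : ℝ} (hb : 0 < b) (hh : 0 < h) (k : ℝ) :
    1 + a * k ^ 2 ≤ symbolM j a b h k := by
  cases j with
  | hilbert =>
      have : 0 ≤ b * |k| := by positivity
      simp only [symbolM]; linarith
  | strip =>
      by_cases hk : k = 0
      · have : 0 ≤ b / h := by positivity
        simp [symbolM, hk, this]
      · have hc := Real.cosh_pos (h * k)
        have key : 0 ≤ k * (Real.cosh (h * k) / Real.sinh (h * k)) := by
          rcases lt_or_gt_of_ne hk with hneg | hpos
          · have : Real.sinh (h * k) < 0 := Real.sinh_neg_iff.2 (mul_neg_of_pos_of_neg hh hneg)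
            exact mul_nonneg_of_nonpos_of_nonpos hneg.le
              (div_nonpos_of_nonneg_of_nonpos hc.le this.le)
          · have : 0 < Real.sinh (h * k) := Real.sinh_pos_iff.2 (mul_pos hh hpos)
            positivity
        have := mul_nonneg hb.le key
        simp only [symbolM, hk, if_false]
        nlinarith

lemma norm_symbolA_le (j : Dispersion) {a b h : ℝ} (ha : 0 < a) (hb : 0 < b) (hh : 0 < h)
    (k : ℝ) : ‖symbolA j a b h k‖ ≤ 1 + 1 / a := by
  have hm := le_symbolM j (a := a) hb hh k
  have hpos : 0 < 1 + a * k ^ 2 := by positivity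
  have : ‖symbolA j a b h k‖ = |k| / symbolM j a b h k := by
    simp [symbolA, symbolPhi, abs_of_pos (hpos.trans_le hm)]
  rw [this, div_le_iff₀ (hpos.trans_le hm)]
  refine le_trans ?_ (mul_le_mul_of_nonneg_left hm (by positivity))
  have h1 : (1 + 1 / a) * (1 + a * k ^ 2) = 1 + k ^ 2 + 1 / a + a * k ^ 2 := by
    field_simp; ring
  have h2 : |k| ≤ 1 + k ^ 2 := by nlinarith [sq_abs k, sq_nonneg (|k| - 1), abs_nonneg k]
  have h3 : 0 < 1 / a := by positivity
  nlinarith [mul_nonneg ha.le (sq_nonneg k)]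

lemma measurable_symbolA (j : Dispersion) (a b h : ℝ) : Measurable (symbolA j a b h) := by
  have hM : Measurable (symbolM j a b h) := by
    cases j with
    | hilbert => unfold symbolM; fun_prop
    | strip =>
        unfold symbolM
        refine Measurable.ite (measurableSet_singleton (0 : ℝ)) (by fun_prop) ?_
        have h1 : Measurable fun k : ℝ => Real.cosh (h * k) :=
          (Real.continuous_cosh.comp (continuous_const_mul h)).measurable
        have h2 : Measurable fun k : ℝ => Real.sinh (h * k) :=
          (Real.continuous_sinh.comp (continuous_const_mul h)).measurable
        fun_prop
  unfold symbolA symbolPhi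
  fun_prop

/-! ### The nonperiodic setting

Mathlib's Fourier transform on `L²(ℝ)` is `𝓕 f ξ = ∫ f(x) exp(-2πi ξ x) dx`, so that
`f̂(k) = (2π)^(-1/2) ∫ f(x) exp(-i k x) dx = (2π)^(-1/2) 𝓕 f (k / 2π)`. Everything below is written
in the variable `ξ = k / 2π`: the multiplier with symbol `p(k)` is `p(2πξ)`, and
`∫ (1 + k²)^s |f̂(k)|² dk = ∫ (1 + (2πξ)²)^s |𝓕 f ξ|² dξ`. -/

/-- `L²(ℝ; ℂ)`. -/
abbrev L2Line : Type := Lp ℂ 2 (volume : Measure ℝ)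

/-- `(1 + k²)^(s/2) f̂`, in the variable `ξ = k / 2π`. -/
def lineWeighted (s : ℝ) (f : L2Line) (ξ : ℝ) : ℂ :=
  ((((1 + (2 * Real.pi * ξ) ^ 2) ^ (s / 2) : ℝ)) : ℂ) * (𝓕 f : L2Line) ξ

/-- The real-valued elements of the Sobolev space `H^s(ℝ)`, `s ≥ 0`, as a real subspace of
`L²(ℝ; ℂ)`. (For `s ≥ 0` every tempered distribution in `H^s(ℝ)` is an `L²` function.) -/
def lineSubmodule (s : ℝ) : Submodule ℝ L2Line where
  carrier := {f | (∀ᵐ x, (f x).im = 0) ∧ MemLp (lineWeighted s f) 2 volume}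
  zero_mem' := by
    constructor
    · filter_upwards [Lp.coeFn_zero ℂ 2 (volume : Measure ℝ)] with x hx
      rw [hx]; rfl
    · refine (memLp_congr_ae ?_).2 (MemLp.zero (ε := ℂ))
      have h0 : (𝓕 (0 : L2Line) : L2Line) = 0 := (Lp.fourierTransformₗᵢ ℝ ℂ).map_zero
      filter_upwards [Lp.coeFn_zero ℂ 2 (volume : Measure ℝ)] with x hx
      rw [lineWeighted, h0, hx]; simp
  add_mem' := by
    rintro f g ⟨hf, hf'⟩ ⟨hg, hg'⟩
    constructor
    · filter_upwards [Lp.coeFn_add f g, hf, hg] with x hx h1 h2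
      rw [hx, Pi.add_apply, Complex.add_im, h1, h2, add_zero]
    · refine (memLp_congr_ae ?_).2 (hf'.add hg')
      have h0 : (𝓕 (f + g) : L2Line) = 𝓕 f + 𝓕 g := (Lp.fourierTransformₗᵢ ℝ ℂ).map_add f g
      filter_upwards [Lp.coeFn_add (𝓕 f : L2Line) (𝓕 g)] with x hx
      simp only [lineWeighted, h0, hx, Pi.add_apply]
      ring
  smul_mem' := by
    rintro c f ⟨hf, hf'⟩
    constructor
    · filter_upwards [Lp.coeFn_smul c f, hf] with x hx h1
      simp [hx, h1]
    · refine (memLp_congr_ae ?_).2 (hf'.const_smul c)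
      have h0 : (𝓕 (c • f) : L2Line) = c • 𝓕 f := by
        have := (Lp.fourierTransformₗᵢ ℝ ℂ).map_smul (c : ℂ) f
        rwa [Complex.coe_smul, Complex.coe_smul] at this
      filter_upwards [Lp.coeFn_smul c (𝓕 f : L2Line)] with x hx
      simp only [lineWeighted, h0, hx, Pi.smul_apply, Complex.real_smul]
      ring

/-- The space `H^s(ℝ)` (real-valued functions), `s ≥ 0`. -/
def HsLine (s : ℝ) : Type := lineSubmodule s

instance (s : ℝ) : AddCommGroup (HsLine s) := inferInstanceAs (AddCommGroup (lineSubmodule s))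
instance (s : ℝ) : Module ℝ (HsLine s) := inferInstanceAs (Module ℝ (lineSubmodule s))

/-- The underlying `L²` function. -/
def HsLine.toL2 {s : ℝ} (u : HsLine s) : L2Line := Subtype.val u

/-- The linear map `f ↦ (1 + k²)^(s/2) f̂` from `H^s(ℝ)` to `L²`. -/
def lineBessel (s : ℝ) : HsLine s →ₗ[ℝ] L2Line where
  toFun u := (Subtype.property u).2.toLp _
  map_add' u v := by
    rw [← MemLp.toLp_add]
    refine MemLp.toLp_congr _ _ ?_
    have h0 : (𝓕 ((u + v : HsLine s).1) : L2Line) = 𝓕 u.1 + 𝓕 v.1 :=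
      (Lp.fourierTransformₗᵢ ℝ ℂ).map_add u.1 v.1
    filter_upwards [Lp.coeFn_add (𝓕 u.1 : L2Line) (𝓕 v.1)] with x hx
    simp only [lineWeighted, h0, hx, Pi.add_apply]
    ring
  map_smul' c u := by
    rw [RingHom.id_apply, ← MemLp.toLp_const_smul]
    refine MemLp.toLp_congr _ _ ?_
    have h0 : (𝓕 ((c • u : HsLine s).1) : L2Line) = c • 𝓕 u.1 := by
      have := (Lp.fourierTransformₗᵢ ℝ ℂ).map_smul (c : ℂ) u.1
      rwa [Complex.coe_smul, Complex.coe_smul] at this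
    filter_upwards [Lp.coeFn_smul c (𝓕 u.1 : L2Line)] with x hx
    simp only [lineWeighted, h0, hx, Pi.smul_apply, Complex.real_smul]
    ring

lemma lineBessel_injective (s : ℝ) : Function.Injective (lineBessel s) := by
  rw [injective_iff_map_eq_zero]
  intro u hu
  have h1 : lineWeighted s u.1 =ᵐ[volume] 0 := by
    have := (MemLp.coeFn_toLp (Subtype.property u).2).symm
    refine this.trans ?_
    have h2 : ((Subtype.property u).2.toLp _ : L2Line) = 0 := hu
    rw [h2]
    exact Lp.coeFn_zero ℂ 2 volume
  have h3 : (𝓕 u.1 : L2Line) = 0 := by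
    refine Lp.ext ?_
    filter_upwards [h1, Lp.coeFn_zero ℂ 2 (volume : Measure ℝ)] with x hx h0
    have hw : (0 : ℝ) < (1 + (2 * Real.pi * x) ^ 2) ^ (s / 2) := by positivity
    have hx' : ((((1 + (2 * Real.pi * x) ^ 2) ^ (s / 2) : ℝ)) : ℂ) * (𝓕 u.1 : L2Line) x = 0 := hx
    rw [h0]
    exact (mul_eq_zero.1 hx').resolve_left (Complex.ofReal_ne_zero.2 hw.ne')
  exact Subtype.ext ((Lp.fourierTransformₗᵢ ℝ ℂ).map_eq_zero_iff.1 h3)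

/-- The `H^s` norm `‖f‖_s = (∫ (1 + k²)^s |f̂(k)|² dk)^(1/2)`. -/
instance (s : ℝ) : NormedAddCommGroup (HsLine s) :=
  NormedAddCommGroup.induced _ _ (lineBessel s) (lineBessel_injective s)

instance (s : ℝ) : NormedSpace ℝ (HsLine s) := NormedSpace.induced ℝ (HsLine s) L2Line (lineBessel s)

lemma memLp_symbolA (j : Dispersion) {a b h : ℝ} (ha : 0 < a) (hb : 0 < b) (hh : 0 < h) :
    MemLp (fun ξ : ℝ => symbolA j a b h (2 * Real.pi * ξ)) ∞ volume :=
  memLp_top_of_bound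
    ((measurable_symbolA j a b h).comp (by fun_prop)).aestronglyMeasurable (1 + 1 / a)
    (Eventually.of_forall fun _ => norm_symbolA_le j ha hb hh _)

/-- The operator `A_j` on `L²(ℝ)`: the Fourier multiplier with symbol `-i φ_j(k)`. -/
def lineA (j : Dispersion) {a b h : ℝ} (ha : 0 < a) (hb : 0 < b) (hh : 0 < h) (f : L2Line) :
    L2Line :=
  𝓕⁻ (((memLp_symbolA j ha hb hh).toLp _ : Lp ℂ ∞ (volume : Measure ℝ)) • (𝓕 f : L2Line) : L2Line)

/-- `v = A_j (u - (3α/4) u²)`, including that `u²` belongs to `L²`. -/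
def IsLineRHS (j : Dispersion) (α : ℝ) {a b h : ℝ} (ha : 0 < a) (hb : 0 < b) (hh : 0 < h) {s : ℝ}
    (u v : HsLine s) : Prop :=
  ∃ q : L2Line, (∀ᵐ x, q x = (u.toL2 x) ^ 2) ∧
    v.toL2 = lineA j ha hb hh (u.toL2 - (3 * α / 4) • q)

/-! ### The periodic setting

`2π`-periodic functions are functions on `AddCircle (2π)`; with the normalized Haar measure,
`fourierBasis.repr f k = f̂(k) = (2π)⁻¹ ∫_{-π}^{π} f(x) exp(-i k x) dx`. -/

instance factTwoPiPos : Fact (0 < 2 * Real.pi) := ⟨Real.two_pi_pos⟩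

/-- `L²` of the circle `ℝ / 2πℤ`. -/
abbrev L2Per : Type := Lp ℂ 2 (AddCircle.haarAddCircle : Measure (AddCircle (2 * Real.pi)))

/-- `(1 + k²)^(s/2) f̂(k)`. -/
def perWeighted (s : ℝ) (f : L2Per) (k : ℤ) : ℂ :=
  ((((1 + (k : ℝ) ^ 2) ^ (s / 2) : ℝ)) : ℂ) * fourierBasis.repr f k

/-- The real-valued elements of the periodic Sobolev space `H^s_per`, `s ≥ 0`, as a real subspace of
`L²` of the circle. (For `s ≥ 0` every periodic distribution in `H^s_per` is an `L²` function.) -/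
def perSubmodule (s : ℝ) : Submodule ℝ L2Per where
  carrier := {f | (∀ᵐ x ∂AddCircle.haarAddCircle, (f x).im = 0) ∧ Memℓp (perWeighted s f) 2}
  zero_mem' := by
    constructor
    · filter_upwards [Lp.coeFn_zero ℂ 2
        (AddCircle.haarAddCircle : Measure (AddCircle (2 * Real.pi)))] with x hx
      rw [hx]; rfl
    · have : perWeighted s 0 = 0 := by
        funext k
        simp [perWeighted]
      rw [this]
      exact zero_memℓp
  add_mem' := by
    rintro f g ⟨hf, hf'⟩ ⟨hg, hg'⟩
    constructor
    · filter_upwards [Lp.coeFn_add f g, hf, hg] with x hx h1 h2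
      rw [hx, Pi.add_apply, Complex.add_im, h1, h2, add_zero]
    · have : perWeighted s (f + g) = perWeighted s f + perWeighted s g := by
        funext k
        simp [perWeighted, mul_add]
      rw [this]
      exact hf'.add hg'
  smul_mem' := by
    rintro c f ⟨hf, hf'⟩
    constructor
    · filter_upwards [Lp.coeFn_smul c f, hf] with x hx h1
      simp [hx, h1]
    · have : perWeighted s (c • f) = c • perWeighted s f := by
        funext k
        have h0 : fourierBasis.repr (c • f) = (c : ℂ) • fourierBasis.repr f := by
          rw [← map_smul]
          rfl
        simp only [perWeighted, h0, Pi.smul_apply, lp.coeFn_smul, Complex.real_smul, smul_eq_mul]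
        ring
      rw [this]
      exact hf'.const_smul c

/-- The space `H^s_per` (real-valued functions), `s ≥ 0`. -/
def HsPer (s : ℝ) : Type := perSubmodule s

instance (s : ℝ) : AddCommGroup (HsPer s) := inferInstanceAs (AddCommGroup (perSubmodule s))
instance (s : ℝ) : Module ℝ (HsPer s) := inferInstanceAs (Module ℝ (perSubmodule s))

/-- The underlying `L²` function. -/
def HsPer.toL2 {s : ℝ} (u : HsPer s) : L2Per := Subtype.val u

/-- The linear map `f ↦ (1 + k²)^(s/2) f̂` from `H^s_per` to `ℓ²(ℤ)`. -/
def perBessel (s : ℝ) : HsPer s →ₗ[ℝ] lp (fun _ : ℤ => ℂ) 2 where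
  toFun u := ⟨perWeighted s u.1, (Subtype.property u).2⟩
  map_add' u v := by
    ext k
    have h0 : fourierBasis.repr ((u + v : HsPer s).1) =
        fourierBasis.repr u.1 + fourierBasis.repr v.1 := map_add _ u.1 v.1
    change perWeighted s (u + v : HsPer s).1 k = perWeighted s u.1 k + perWeighted s v.1 k
    simp [perWeighted, h0, mul_add]
  map_smul' c u := by
    ext k
    have h0 : fourierBasis.repr ((c • u : HsPer s).1) = (c : ℂ) • fourierBasis.repr u.1 := by
      rw [← map_smul]
      rfl
    simp only [perWeighted, h0, lp.coeFn_smul, Pi.smul_apply, smul_eq_mul, RingHom.id_apply,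
      Complex.real_smul]
    ring

lemma perBessel_injective (s : ℝ) : Function.Injective (perBessel s) := by
  rw [injective_iff_map_eq_zero]
  intro u hu
  have h3 : fourierBasis.repr u.1 = 0 := by
    ext k
    have hk : perWeighted s u.1 k = 0 := by
      have := congrArg (fun w : lp (fun _ : ℤ => ℂ) 2 => w k) hu
      exact this
    have hw : (0 : ℝ) < (1 + (k : ℝ) ^ 2) ^ (s / 2) := by positivity
    exact (mul_eq_zero.1 hk).resolve_left (Complex.ofReal_ne_zero.2 hw.ne')
  exact Subtype.ext (fourierBasis.repr.map_eq_zero_iff.1 h3)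

/-- The `H^s_per` norm `‖f‖_s = (∑ (1 + k²)^s |f̂(k)|²)^(1/2)`. -/
instance (s : ℝ) : NormedAddCommGroup (HsPer s) :=
  NormedAddCommGroup.induced _ _ (perBessel s) (perBessel_injective s)

instance (s : ℝ) : NormedSpace ℝ (HsPer s) :=
  NormedSpace.induced ℝ (HsPer s) (lp (fun _ : ℤ => ℂ) 2) (perBessel s)

lemma memℓp_symbolA (j : Dispersion) {a b h : ℝ} (ha : 0 < a) (hb : 0 < b) (hh : 0 < h)
    (w : lp (fun _ : ℤ => ℂ) 2) : Memℓp (fun k : ℤ => symbolA j a b h k * w k) 2 := by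
  refine ((memℓp_norm_iff.2 (lp.memℓp w)).const_mul (1 + 1 / a)).mono fun k => ?_
  rw [norm_mul]
  exact mul_le_mul_of_nonneg_right (norm_symbolA_le j ha hb hh _) (norm_nonneg _)

/-- The operator `A_j` on `L²` of the circle: the Fourier multiplier with symbol `-i φ_j(k)`,
`k ∈ ℤ`. -/
def perA (j : Dispersion) {a b h : ℝ} (ha : 0 < a) (hb : 0 < b) (hh : 0 < h) (f : L2Per) :
    L2Per :=
  fourierBasis.repr.symm ⟨fun k : ℤ => symbolA j a b h k * fourierBasis.repr f k,
    memℓp_symbolA j ha hb hh (fourierBasis.repr f)⟩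

/-- `v = A_j (u - (3α/4) u²)`, including that `u²` belongs to `L²`. -/
def IsPerRHS (j : Dispersion) (α : ℝ) {a b h : ℝ} (ha : 0 < a) (hb : 0 < b) (hh : 0 < h) {s : ℝ}
    (u v : HsPer s) : Prop :=
  ∃ q : L2Per, (∀ᵐ x ∂AddCircle.haarAddCircle, q x = (u.toL2 x) ^ 2) ∧
    v.toL2 = perA j ha hb hh (u.toL2 - (3 * α / 4) • q)

end RegBenjamin

end

open scoped NNReal RealInnerProductSpace
open scoped Convolution ComplexConjugate
open ContinuousLinearMap (mul)

noncomputable section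

namespace RegBenjamin

/-! The equation is an ODE in `H^s` whose field is Lipschitz on bounded sets, because the symbol of
`A_j` decays like `1/|k|`: the operator gains the derivative that makes the quadratic term harmless.
Global existence rests on a conserved energy and on a tame estimate.

Multiplying by `m_j` turns the equation into `m_j(D) η_t = -(η - (3α/4) η²)_x`, so the natural
energy is `E(u) = ∫ m_j |û|²`. Its derivative along the field has a linear part, which vanishes
because the symbol is imaginary, and a cubic part proportional to `∫ u_x u² = 0`. As `m_j` is
comparable to `1 + k²`, the energy is equivalent to the square of the `H¹` norm. This norm in turn
bounds `‖û‖_{L¹}` by Cauchy-Schwarz, `(1 + k²)^(-1/2)` being square integrable over `ℝ` and over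
`ℤ`.

The tame estimate `‖u²‖_{s-1} ≤ C ‖û‖_{L¹} ‖u‖_{s-1}`, valid as `s ≥ 1`, and the gain of one
derivative give `‖F u‖_s ≤ C (1 + E(u)^(1/2)) ‖u‖_s`. The growth is thus linear, with a rate fixed
by a conserved quantity, and Grönwall's inequality bounds `‖η(t)‖_s` on each bounded time interval.

The abstract half is `IsEnergyField.globallyWellPosed`. Its hypotheses are checked in
`modelField_isEnergyField`, in the variable `g = (1 + k²)^(s/2) û`, for a measured group that covers
both `ℝ` and `ℤ`. The decisive inputs are `eLpNorm_bilinearTerm_le` and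
`integral_cubicIntegrand_eq_zero`. What remains is to carry the result back along the Bessel
isometry and to recognise the convolution `û * û` as the transform of the pointwise square. -/

/-! ### Autonomous equations with a conserved quadratic energy -/

section EnergyField

variable {Y H : Type*} [NormedAddCommGroup Y] [NormedSpace ℝ Y]
  [NormedAddCommGroup H] [InnerProductSpace ℝ H]

/-- A vector field `F`, Lipschitz on bounded sets, which conserves the energy `‖J u‖²` and grows at
most linearly, with a rate that is controlled by the energy. -/
structure IsEnergyField (F : Y → Y) (J : Y →L[ℝ] H) (C : ℝ) : Prop where
  nonneg : 0 ≤ C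
  lipschitz : ∀ R : ℝ, ∃ K : ℝ≥0, LipschitzOnWith K F (Metric.closedBall 0 R)
  energy : ∀ u, ⟪J u, J (F u)⟫ = 0
  growth : ∀ u, ‖F u‖ ≤ C * (1 + ‖J u‖) * ‖u‖

variable {F : Y → Y} {J : Y →L[ℝ] H} {C T : ℝ} {φ ψ : Y} {η ζ : ℝ → Y}

lemma IsEnergyField.neg (hF : IsEnergyField F J C) : IsEnergyField (fun u => -F u) J C where
  nonneg := hF.nonneg
  lipschitz R := (hF.lipschitz R).imp fun _ hK => hK.neg
  energy u := by simp [hF.energy u]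
  growth u := by simpa using hF.growth u

/-- Time reversal. Since `-F` satisfies the same structural hypotheses as `F`, every estimate need
only be proved for `t ≥ 0`. -/
lemma IsSolutionOn.comp_neg (hη : IsSolutionOn F φ T η) :
    IsSolutionOn (fun u => -F u) φ T (fun t => η (-t)) := by
  have hmaps : Set.MapsTo (fun t : ℝ => -t) (Set.Icc (-T) T) (Set.Icc (-T) T) := fun t ht =>
    ⟨neg_le_neg ht.2, by linarith [ht.1]⟩
  refine ⟨hη.continuousOn.comp continuous_neg.continuousOn hmaps, by simpa using hη.init, ?_⟩
  intro t ht
  have h := (hη.hasDeriv (-t) (hmaps ht)).scomp t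
    ((hasDerivAt_neg t).hasDerivWithinAt (s := Set.Icc (-T) T)) hmaps
  simpa [Function.comp_def] using h

lemma IsSolutionOn.mono (hη : IsSolutionOn F φ T η) {S : ℝ} (hST : S ≤ T) :
    IsSolutionOn F φ S η := by
  have hsub : Set.Icc (-S) S ⊆ Set.Icc (-T) T := Set.Icc_subset_Icc (by linarith) hST
  exact ⟨hη.continuousOn.mono hsub, hη.init, fun t ht => (hη.hasDeriv t (hsub ht)).mono hsub⟩

lemma IsSolutionOn.continuousOn_nonneg (hη : IsSolutionOn F φ T η) (hT : 0 ≤ T) :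
    ContinuousOn η (Set.Icc 0 T) :=
  hη.continuousOn.mono (Set.Icc_subset_Icc_left (by linarith))

lemma IsSolutionOn.hasDerivWithinAt_Ici (hη : IsSolutionOn F φ T η) {t : ℝ}
    (ht : t ∈ Set.Ico 0 T) : HasDerivWithinAt η (F (η t)) (Set.Ici t) t := by
  have h1 : t ∈ Set.Icc (-T) T := ⟨by linarith [ht.1, ht.2], ht.2.le⟩
  refine ((hη.hasDeriv t h1).mono (Set.Icc_subset_Icc_left h1.1)).mono_of_mem_nhdsWithin ?_
  exact Icc_mem_nhdsGE ht.2

lemma IsGlobalSolution.isSolutionOn (hη : IsGlobalSolution F φ η) : IsSolutionOn F φ T η :=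
  ⟨hη.continuous.continuousOn, hη.init, fun t _ => (hη.hasDeriv t).hasDerivWithinAt⟩

/-- The a priori bound that energy conservation and Grönwall's inequality give for solutions. -/
def aprioriBound (J : Y →L[ℝ] H) (C T : ℝ) (φ : Y) : ℝ :=
  ‖φ‖ * Real.exp (C * (1 + ‖J φ‖) * T)

/-- The derivative of `‖J η‖²` is `2⟪J η, J (F η)⟫ = 0`. -/
lemma IsEnergyField.norm_map_eq (hF : IsEnergyField F J C) (hη : IsSolutionOn F φ T η) {t : ℝ}
    (ht : t ∈ Set.Icc 0 T) : ‖J (η t)‖ = ‖J φ‖ := by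
  have hT : 0 ≤ T := ht.1.trans ht.2
  have h := constant_of_has_deriv_right_zero (f := fun t => ‖J (η t)‖ ^ 2) (a := 0) (b := T)
    ((J.continuous.comp_continuousOn (hη.continuousOn_nonneg hT)).norm.pow 2) (by
      intro x hx
      have h1 := (J.hasFDerivAt.comp_hasDerivWithinAt x (hη.hasDerivWithinAt_Ici hx)).norm_sq
      simpa [hF.energy] using h1) t ht
  rw [← hη.init]
  exact (sq_eq_sq₀ (norm_nonneg _) (norm_nonneg _)).1 h

/-- Along a solution the growth rate is frozen at its initial value by conservation of energy, so
Grönwall's inequality applies with a constant rate. -/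
lemma IsEnergyField.norm_le_of_nonneg (hF : IsEnergyField F J C) (hη : IsSolutionOn F φ T η)
    {t : ℝ} (ht : t ∈ Set.Icc 0 T) : ‖η t‖ ≤ aprioriBound J C T φ := by
  have hT : 0 ≤ T := ht.1.trans ht.2
  have h := norm_le_gronwallBound_of_norm_deriv_right_le (δ := ‖φ‖) (ε := 0)
    (K := C * (1 + ‖J φ‖)) (hη.continuousOn_nonneg hT) (fun x hx => hη.hasDerivWithinAt_Ici hx)
    (by rw [hη.init]) (fun x hx => by
      have := hF.growth (η x)
      rwa [hF.norm_map_eq hη (Set.Ico_subset_Icc_self hx), ← add_zero (_ * ‖η x‖)] at this) t ht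
  rw [gronwallBound_ε0, sub_zero] at h
  refine h.trans ?_
  have := hF.nonneg
  unfold aprioriBound
  gcongr
  exact ht.2

lemma IsEnergyField.norm_le (hF : IsEnergyField F J C) (hη : IsSolutionOn F φ T η)
    {t : ℝ} (ht : t ∈ Set.Icc (-T) T) : ‖η t‖ ≤ aprioriBound J C T φ := by
  rcases le_total 0 t with h | h
  · exact hF.norm_le_of_nonneg hη ⟨h, ht.2⟩
  · simpa using hF.neg.norm_le_of_nonneg hη.comp_neg (t := -t)
      ⟨by linarith, by linarith [ht.1]⟩

lemma dist_le_of_isSolutionOn_of_nonneg {K : ℝ≥0} {R : ℝ}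
    (hK : LipschitzOnWith K F (Metric.closedBall 0 R))
    (hη : IsSolutionOn F φ T η) (hζ : IsSolutionOn F ψ T ζ)
    (hηR : ∀ t ∈ Set.Icc (-T) T, ‖η t‖ ≤ R) (hζR : ∀ t ∈ Set.Icc (-T) T, ‖ζ t‖ ≤ R)
    {t : ℝ} (ht : t ∈ Set.Icc 0 T) : dist (η t) (ζ t) ≤ dist φ ψ * Real.exp (K * T) := by
  have hT : 0 ≤ T := ht.1.trans ht.2
  have hsub : Set.Ico 0 T ⊆ Set.Icc (-T) T := fun x hx => ⟨by linarith [hx.1], hx.2.le⟩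
  have h := dist_le_of_trajectories_ODE_of_mem (v := fun _ => F) (K := K)
    (s := fun _ => Metric.closedBall 0 R) (δ := dist φ ψ) (fun _ _ => hK)
    (hη.continuousOn_nonneg hT) (fun x hx => hη.hasDerivWithinAt_Ici hx)
    (fun x hx => by simpa using hηR x (hsub hx))
    (hζ.continuousOn_nonneg hT) (fun x hx => hζ.hasDerivWithinAt_Ici hx)
    (fun x hx => by simpa using hζR x (hsub hx)) (by rw [hη.init, hζ.init]) t ht
  rw [sub_zero] at h
  refine h.trans ?_
  gcongr
  exact ht.2

lemma dist_le_of_isSolutionOn {K : ℝ≥0} {R : ℝ}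
    (hK : LipschitzOnWith K F (Metric.closedBall 0 R))
    (hη : IsSolutionOn F φ T η) (hζ : IsSolutionOn F ψ T ζ)
    (hηR : ∀ t ∈ Set.Icc (-T) T, ‖η t‖ ≤ R) (hζR : ∀ t ∈ Set.Icc (-T) T, ‖ζ t‖ ≤ R)
    {t : ℝ} (ht : t ∈ Set.Icc (-T) T) : dist (η t) (ζ t) ≤ dist φ ψ * Real.exp (K * T) := by
  rcases le_total 0 t with h | h
  · exact dist_le_of_isSolutionOn_of_nonneg hK hη hζ hηR hζR ⟨h, ht.2⟩
  · have hmaps : ∀ t ∈ Set.Icc (-T) T, -t ∈ Set.Icc (-T) T := fun t ht =>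
      ⟨neg_le_neg ht.2, by linarith [ht.1]⟩
    simpa using dist_le_of_isSolutionOn_of_nonneg hK.neg hη.comp_neg hζ.comp_neg
      (fun t ht => hηR _ (hmaps t ht)) (fun t ht => hζR _ (hmaps t ht)) (t := -t)
      ⟨by linarith, by linarith [ht.1]⟩

lemma IsEnergyField.eqOn (hF : IsEnergyField F J C) (hη : IsSolutionOn F φ T η)
    (hζ : IsSolutionOn F φ T ζ) : Set.EqOn η ζ (Set.Icc (-T) T) := by
  intro t ht
  obtain ⟨K, hK⟩ := hF.lipschitz (aprioriBound J C T φ)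
  have := dist_le_of_isSolutionOn hK hη hζ (fun _ h => hF.norm_le hη h)
    (fun _ h => hF.norm_le hζ h) ht
  rw [dist_self, zero_mul] at this
  exact dist_le_zero.1 this

/-- A cut-off of the radius: `1` on `[0, R]`, `0` on `[R + 1, ∞)`, and `1`-Lipschitz. -/
def radialCutoff (R r : ℝ) : ℝ := max 0 (min 1 (R + 1 - r))

lemma radialCutoff_nonneg (R r : ℝ) : 0 ≤ radialCutoff R r := le_max_left _ _

lemma radialCutoff_le_one (R r : ℝ) : radialCutoff R r ≤ 1 :=
  max_le zero_le_one (min_le_left _ _)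

lemma radialCutoff_eq_one {R r : ℝ} (h : r ≤ R) : radialCutoff R r = 1 := by
  rw [radialCutoff, min_eq_left (by linarith), max_eq_right zero_le_one]

lemma radialCutoff_eq_zero {R r : ℝ} (h : R + 1 ≤ r) : radialCutoff R r = 0 := by
  rw [radialCutoff, max_eq_left]
  exact (min_le_right _ _).trans (by linarith)

lemma abs_radialCutoff_sub_le (R r r' : ℝ) :
    |radialCutoff R r - radialCutoff R r'| ≤ |r - r'| := by
  unfold radialCutoff
  calc |max 0 (min 1 (R + 1 - r)) - max 0 (min 1 (R + 1 - r'))|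
      ≤ |min 1 (R + 1 - r) - min 1 (R + 1 - r')| := by
        have := abs_max_sub_max_le_max 0 (min 1 (R + 1 - r)) 0 (min 1 (R + 1 - r'))
        simpa using this
    _ ≤ |(R + 1 - r) - (R + 1 - r')| := by
        have := abs_min_sub_min_le_max 1 (R + 1 - r) 1 (R + 1 - r')
        simpa using this
    _ = |r - r'| := by rw [sub_sub_sub_cancel_left, abs_sub_comm]

/-- The vector field `F`, cut off outside of the ball of radius `R`. -/
def cutoffField (F : Y → Y) (R : ℝ) (u : Y) : Y := radialCutoff R ‖u‖ • F u

lemma IsEnergyField.exists_bound (hF : IsEnergyField F J C) (R : ℝ) :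
    ∃ M : ℝ≥0, ∀ u, ‖u‖ ≤ R → ‖F u‖ ≤ M := by
  refine ⟨Real.toNNReal (C * (1 + ‖J‖ * R) * R), fun u hu => ?_⟩
  refine le_trans ?_ (Real.le_coe_toNNReal _)
  have := hF.nonneg
  have hR : 0 ≤ R := (norm_nonneg u).trans hu
  refine (hF.growth u).trans ?_
  have : ‖J u‖ ≤ ‖J‖ * R := (J.le_opNorm u).trans (by gcongr)
  gcongr

lemma IsEnergyField.exists_bound_cutoff (hF : IsEnergyField F J C) (R : ℝ) :
    ∃ M : ℝ≥0, ∀ u, ‖cutoffField F R u‖ ≤ M := by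
  obtain ⟨M, hM⟩ := hF.exists_bound (R + 1)
  refine ⟨M, fun u => ?_⟩
  rw [cutoffField, norm_smul, Real.norm_of_nonneg (radialCutoff_nonneg _ _)]
  rcases le_total ‖u‖ (R + 1) with h | h
  · calc _ ≤ 1 * ‖F u‖ := by gcongr; exact radialCutoff_le_one _ _
      _ ≤ M := by rw [one_mul]; exact hM u h
  · rw [radialCutoff_eq_zero h, zero_mul]; exact M.2

/-- A scalar factor in `[0, 1]` destroys neither the orthogonality that conserves the energy nor the
growth bound. The truncated equation therefore has the same `J` and `C`, hence the same a priori
bound. -/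
lemma IsEnergyField.cutoff (hF : IsEnergyField F J C) (R : ℝ) :
    IsEnergyField (cutoffField F R) J C where
  nonneg := hF.nonneg
  lipschitz S := by
    obtain ⟨K, hK⟩ := hF.lipschitz S
    obtain ⟨M, hM⟩ := hF.exists_bound S
    refine ⟨K + M, LipschitzOnWith.of_dist_le_mul fun u hu v hv => ?_⟩
    have hu' : ‖u‖ ≤ S := by simpa using hu
    have h1 : ‖F u - F v‖ ≤ K * ‖u - v‖ := by
      simpa [dist_eq_norm] using hK.dist_le_mul u hu v hv
    have h2 : cutoffField F R u - cutoffField F R v =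
        radialCutoff R ‖v‖ • (F u - F v) + (radialCutoff R ‖u‖ - radialCutoff R ‖v‖) • F u := by
      simp only [cutoffField]; module
    have h3 : |radialCutoff R ‖u‖ - radialCutoff R ‖v‖| ≤ ‖u - v‖ :=
      (abs_radialCutoff_sub_le _ _ _).trans (abs_norm_sub_norm_le u v)
    rw [dist_eq_norm, dist_eq_norm, h2]
    refine (norm_add_le _ _).trans ?_
    rw [norm_smul, norm_smul, Real.norm_of_nonneg (radialCutoff_nonneg _ _), Real.norm_eq_abs]
    calc _ ≤ 1 * (K * ‖u - v‖) + ‖u - v‖ * M := by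
          gcongr
          · exact radialCutoff_le_one _ _
          · exact hM u hu'
      _ = (K + M : ℝ≥0) * ‖u - v‖ := by push_cast; ring
  energy u := by simp [cutoffField, inner_smul_right, hF.energy]
  growth u := by
    rw [cutoffField, norm_smul, Real.norm_of_nonneg (radialCutoff_nonneg _ _)]
    calc _ ≤ 1 * ‖F u‖ := by gcongr; exact radialCutoff_le_one _ _
      _ ≤ _ := by rw [one_mul]; exact hF.growth u

/-- No continuation argument is needed. The field truncated at the a priori radius is bounded, so
Picard-Lindelöf works on all of `[-T, T]` at once; its solution obeys the a priori bound and so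
never reaches the region where the truncation acts. -/
lemma IsEnergyField.exists_isSolutionOn [CompleteSpace Y] (hF : IsEnergyField F J C)
    (hT : 0 ≤ T) (φ : Y) : ∃ η, IsSolutionOn F φ T η := by
  set R := aprioriBound J C T φ
  have hG := hF.cutoff R
  obtain ⟨M, hM⟩ := hF.exists_bound_cutoff R
  -- At speed at most `M` the solution stays within `M T` of `φ`. The Lipschitz constant is taken on
  -- a ball about `0` that contains this ball about `φ`.
  set a : ℝ≥0 := M * Real.toNNReal T
  obtain ⟨K, hK⟩ := hG.lipschitz (a + ‖φ‖)
  have hPL : IsPicardLindelof (fun _ => cutoffField F R) (tmin := -T) (tmax := T)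
      ⟨0, by simpa using hT, hT⟩ φ a 0 M K := by
    refine .of_time_independent (fun u _ => hM u) (hK.mono ?_) ?_
    · refine Metric.closedBall_subset_closedBall' ?_
      rw [dist_zero_right]
    · simp [a, hT]
  obtain ⟨η, h0, hη⟩ := hPL.exists_eq_forall_mem_Icc_hasDerivWithinAt₀
  have hsol : IsSolutionOn (cutoffField F R) φ T η :=
    ⟨fun t ht => (hη t ht).continuousWithinAt, h0, hη⟩
  refine ⟨η, hsol.continuousOn, h0, fun t ht => ?_⟩
  have h1 := hη t ht
  rwa [cutoffField, radialCutoff_eq_one (hG.norm_le hsol ht), one_smul] at h1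

lemma IsEnergyField.wellPosedOn [CompleteSpace Y] (hF : IsEnergyField F J C) (hT : 0 < T)
    (φ : Y) : WellPosedOn F φ T where
  exists_solution := hF.exists_isSolutionOn hT.le φ
  unique _ _ h₁ h₂ := hF.eqOn h₁ h₂
  continuous_dependence φs φ' η' hφ hη' := by
    choose ηs hηs using fun n => hF.exists_isSolutionOn hT.le (φs n)
    refine ⟨ηs, Eventually.of_forall hηs, ?_⟩
    have hcont : Continuous (aprioriBound J C T) := by unfold aprioriBound; fun_prop
    -- The a priori bound is continuous in the datum. The margin `1` lets a single ball, hence a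
    -- single Lipschitz constant, serve the limit and almost all `φs n`.
    set R := aprioriBound J C T φ' + 1
    have hR : ∀ᶠ n in atTop, aprioriBound J C T (φs n) ≤ R :=
      ((hcont.tendsto φ').comp hφ).eventually (Iic_mem_nhds (lt_add_one _))
    obtain ⟨K, hK⟩ := hF.lipschitz R
    have hlim : Tendsto (fun n => dist φ' (φs n) * Real.exp (K * T)) atTop (𝓝 0) := by
      have := (tendsto_const_nhds (x := φ')).dist hφ
      rw [dist_self] at this
      simpa using this.mul_const (Real.exp (K * T))
    rw [Metric.tendstoUniformlyOn_iff]
    intro ε hε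
    filter_upwards [hR, hlim.eventually (gt_mem_nhds hε)] with n hn hnε t ht
    refine lt_of_le_of_lt ?_ hnε
    exact dist_le_of_isSolutionOn hK hη' (hηs n)
      (fun t ht => (hF.norm_le hη' ht).trans (lt_add_one _).le)
      (fun t ht => (hF.norm_le (hηs n) ht).trans hn) ht

theorem IsEnergyField.globallyWellPosed [CompleteSpace Y] (hF : IsEnergyField F J C) (φ : Y) :
    GloballyWellPosed F φ where
  wellPosedOn _ hT := hF.wellPosedOn hT φ
  existsUnique := by
    -- The global solution is glued from solutions on `[-n, n]`, which agree on overlaps by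
    -- uniqueness.
    choose ηs hηs using fun n : ℕ => hF.exists_isSolutionOn (T := n) n.cast_nonneg φ
    have hmem : ∀ {t : ℝ} {n : ℕ}, |t| ≤ n → t ∈ Set.Icc (-(n : ℝ)) n := fun h => abs_le.1 h
    have hcons : ∀ {t : ℝ} {m n : ℕ}, |t| ≤ m → |t| ≤ n → ηs m t = ηs n t := by
      intro t m n hm hn
      rcases le_total m n with h | h
      · exact hF.eqOn (hηs m) ((hηs n).mono (by exact_mod_cast h)) (hmem hm)
      · exact hF.eqOn ((hηs m).mono (by exact_mod_cast h)) (hηs n) (hmem hn)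
    set η : ℝ → Y := fun t => ηs ⌈|t|⌉₊ t
    have hη : ∀ {t : ℝ} {n : ℕ}, |t| ≤ n → η t = ηs n t := fun h => hcons (Nat.le_ceil _) h
    have hderiv : ∀ t, HasDerivAt η (F (η t)) t := by
      intro t
      obtain ⟨n, hn⟩ := exists_nat_gt |t|
      have hnhds : Set.Icc (-(n : ℝ)) n ∈ 𝓝 t := Icc_mem_nhds (abs_lt.1 hn).1 (abs_lt.1 hn).2
      rw [hη hn.le]
      refine (((hηs n).hasDeriv t (hmem hn.le)).hasDerivAt hnhds).congr_of_eventuallyEq ?_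
      filter_upwards [hnhds] with x hx using hη (abs_le.2 hx)
    refine ⟨η, ⟨continuous_iff_continuousAt.2 fun t => (hderiv t).continuousAt, ?_, hderiv⟩, ?_⟩
    · exact (hηs _).init
    · intro ζ hζ
      funext t
      exact hF.eqOn (T := (⌈|t|⌉₊ : ℝ)) hζ.isSolutionOn (hηs _) (hmem (Nat.le_ceil _))

end EnergyField

/-! ### Young's inequality for nonnegative functions on a group -/

section Young

variable {G : Type*} [AddCommGroup G] [MeasurableSpace G] [MeasurableAdd₂ G] [MeasurableNeg G]
  {μ : Measure G} [SFinite μ] [μ.IsAddLeftInvariant]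

/-- Cauchy-Schwarz for the factors `f^(1/2)` and `f^(1/2) g`, that is, with respect to the measure
`f dν`. -/
lemma sq_lintegral_mul_le {α : Type*} [MeasurableSpace α] (ν : Measure α) {f g : α → ℝ≥0∞}
    (hf : Measurable f) (hg : Measurable g) :
    (∫⁻ y, f y * g y ∂ν) ^ 2 ≤ (∫⁻ y, f y ∂ν) * ∫⁻ y, f y * g y ^ 2 ∂ν := by
  have hsq : ∀ y, f y ^ (2⁻¹ : ℝ) * f y ^ (2⁻¹ : ℝ) = f y := fun y => by
    rw [← ENNReal.rpow_add_of_nonneg _ _ (by norm_num) (by norm_num)]; norm_num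
  have h := ENNReal.lintegral_mul_le_Lp_mul_Lq ν Real.HolderConjugate.two_two
    (hf.pow_const (2⁻¹ : ℝ)).aemeasurable ((hf.pow_const (2⁻¹ : ℝ)).mul hg).aemeasurable
  simp only [Pi.mul_apply, ← mul_assoc, hsq, ENNReal.rpow_two, mul_pow, one_div] at h
  simp only [sq (_ ^ (2⁻¹ : ℝ)), hsq] at h
  have h2 := pow_le_pow_left' h 2
  rw [mul_pow] at h2
  simpa only [← ENNReal.rpow_mul_natCast, Nat.cast_ofNat, inv_mul_cancel₀ (two_ne_zero' ℝ),
    ENNReal.rpow_one] using h2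

/-- Young's inequality `L¹ * L² ⊆ L²`. -/
lemma eLpNorm_lintegral_mul_sub_le {f g : G → ℝ≥0∞} (hf : Measurable f) (hg : Measurable g) :
    eLpNorm (fun x => ∫⁻ y, f y * g (x - y) ∂μ) 2 μ ≤ (∫⁻ y, f y ∂μ) * eLpNorm g 2 μ := by
  have key : ∫⁻ x, (∫⁻ y, f y * g (x - y) ∂μ) ^ 2 ∂μ ≤ (∫⁻ y, f y ∂μ) ^ 2 * ∫⁻ x, g x ^ 2 ∂μ := by
    -- Cauchy-Schwarz at each `x`, then Tonelli; translation invariance makes the inner integral of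
    -- `g²` independent of `y`.
    calc ∫⁻ x, (∫⁻ y, f y * g (x - y) ∂μ) ^ 2 ∂μ
        ≤ ∫⁻ x, (∫⁻ y, f y ∂μ) * ∫⁻ y, f y * g (x - y) ^ 2 ∂μ ∂μ :=
          lintegral_mono fun x => sq_lintegral_mul_le μ hf (by fun_prop)
      _ = (∫⁻ y, f y ∂μ) * ∫⁻ x, ∫⁻ y, f y * g (x - y) ^ 2 ∂μ ∂μ :=
          lintegral_const_mul _ (Measurable.lintegral_prod_right' (f := fun z : G × G =>
            f z.2 * g (z.1 - z.2) ^ 2) (by fun_prop))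
      _ = (∫⁻ y, f y ∂μ) * ∫⁻ y, ∫⁻ x, f y * g (x - y) ^ 2 ∂μ ∂μ := by
          rw [lintegral_lintegral_swap (by fun_prop)]
      _ = (∫⁻ y, f y ∂μ) ^ 2 * ∫⁻ x, g x ^ 2 ∂μ := by
          have : ∀ y, ∫⁻ x, f y * g (x - y) ^ 2 ∂μ = f y * ∫⁻ x, g x ^ 2 ∂μ := fun y => by
            rw [lintegral_const_mul _ (by fun_prop),
              lintegral_sub_right_eq_self (fun x => g x ^ 2)]
          simp_rw [this]
          rw [lintegral_mul_const _ hf, ← mul_assoc, sq]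
  have h2 := ENNReal.rpow_le_rpow key (z := 2⁻¹) (by norm_num)
  rw [ENNReal.mul_rpow_of_nonneg _ _ (by norm_num), ← ENNReal.rpow_natCast_mul] at h2
  simpa [eLpNorm_eq_lintegral_rpow_enorm_toReal] using h2

end Young

/-! ### Weights and convolutions -/

section Weight

variable {G : Type*} [AddCommGroup G]

/-- The weight `(1 + κ²)^(σ/2)`. -/
def sobolevWeight (κ : G →+ ℝ) (σ : ℝ) (ξ : G) : ℝ := (1 + κ ξ ^ 2) ^ (σ / 2)

variable (κ : G →+ ℝ) (σ τ : ℝ) (ξ : G)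

lemma sobolevWeight_pos : 0 < sobolevWeight κ σ ξ := by unfold sobolevWeight; positivity

lemma sobolevWeight_nonneg : 0 ≤ sobolevWeight κ σ ξ := (sobolevWeight_pos κ σ ξ).le

lemma sobolevWeight_neg_apply : sobolevWeight κ σ (-ξ) = sobolevWeight κ σ ξ := by
  simp [sobolevWeight]

lemma sobolevWeight_mul :
    sobolevWeight κ σ ξ * sobolevWeight κ τ ξ = sobolevWeight κ (σ + τ) ξ := by
  rw [sobolevWeight, sobolevWeight, sobolevWeight, add_div, Real.rpow_add (by positivity)]

lemma sobolevWeight_zero : sobolevWeight κ 0 ξ = 1 := by simp [sobolevWeight]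

lemma sobolevWeight_two : sobolevWeight κ 2 ξ = 1 + κ ξ ^ 2 := by simp [sobolevWeight]

variable {σ τ} in
lemma sobolevWeight_le (h : σ ≤ τ) : sobolevWeight κ σ ξ ≤ sobolevWeight κ τ ξ :=
  Real.rpow_le_rpow_of_exponent_le (by nlinarith [sq_nonneg (κ ξ)]) (by linarith)

variable {σ} in
lemma sobolevWeight_le_one (h : σ ≤ 0) : sobolevWeight κ σ ξ ≤ 1 := by
  simpa [sobolevWeight_zero] using sobolevWeight_le κ ξ h

lemma abs_le_sobolevWeight_one : |κ ξ| ≤ sobolevWeight κ 1 ξ := by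
  rw [sobolevWeight, ← Real.sqrt_eq_rpow]
  exact Real.abs_le_sqrt (by linarith)

-- One of `|κ y|`, `|κ (x - y)|` is at least `|κ x| / 2`, whence `1 + κ(x)² ≤ 4 (1 + κ(z)²)` for `z
-- = y` or `z = x - y`. The power `σ/2` turns `4` into `2^σ`. This splitting of the weight is the
-- source of the tame estimate.
variable {σ} in
lemma sobolevWeight_le_add (h : 0 ≤ σ) (x y : G) :
    sobolevWeight κ σ x ≤ 2 ^ σ * (sobolevWeight κ σ y + sobolevWeight κ σ (x - y)) := by
  have key : ∀ {z : G}, 1 + κ x ^ 2 ≤ 4 * (1 + κ z ^ 2) →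
      sobolevWeight κ σ x ≤ 2 ^ σ * sobolevWeight κ σ z := by
    intro z hz
    have h4 : (4 : ℝ) ^ (σ / 2) = 2 ^ σ := by
      rw [show (4 : ℝ) = 2 ^ (2 : ℝ) by norm_num, ← Real.rpow_mul (by norm_num)]
      congr 1; ring
    rw [sobolevWeight, sobolevWeight, ← h4, ← Real.mul_rpow (by norm_num) (by positivity)]
    exact Real.rpow_le_rpow (by positivity) hz (by positivity)
  have h1 := sobolevWeight_nonneg κ σ y
  have h2 := sobolevWeight_nonneg κ σ (x - y)
  have h3 : (0 : ℝ) ≤ 2 ^ σ := by positivity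
  have hx : κ x = κ y + κ (x - y) := by rw [← map_add]; congr 1; abel
  rcases le_total (κ y ^ 2) (κ (x - y) ^ 2) with hle | hle
  · refine (key (z := x - y) ?_).trans (by gcongr; linarith)
    rw [hx]
    nlinarith [sq_nonneg (κ y - κ (x - y))]
  · refine (key (z := y) ?_).trans (by gcongr; linarith)
    rw [hx]
    nlinarith [sq_nonneg (κ y - κ (x - y))]

variable {κ} in
lemma measurable_sobolevWeight [MeasurableSpace G] (hκ : Measurable κ) :
    Measurable (sobolevWeight κ σ) := by
  unfold sobolevWeight; fun_prop

/-- Multiplication of a function by the weight `(1 + κ²)^(σ/2)`. -/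
def weighted (κ : G →+ ℝ) (σ : ℝ) (f : G → ℂ) (ξ : G) : ℂ := (sobolevWeight κ σ ξ : ℂ) * f ξ

variable {κ} in
lemma measurable_weighted [MeasurableSpace G] (hκ : Measurable κ) {f : G → ℂ}
    (hf : Measurable f) : Measurable (weighted κ σ f) := by
  have := measurable_sobolevWeight σ hκ
  unfold weighted; fun_prop

lemma enorm_weighted (f : G → ℂ) :
    ‖weighted κ σ f ξ‖ₑ = ENNReal.ofReal (sobolevWeight κ σ ξ) * ‖f ξ‖ₑ := by
  rw [weighted, enorm_mul, ← Real.enorm_of_nonneg (sobolevWeight_nonneg κ σ ξ)]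
  congr 1
  simp [enorm_eq_nnnorm]

lemma norm_weighted (f : G → ℂ) : ‖weighted κ σ f ξ‖ = sobolevWeight κ σ ξ * ‖f ξ‖ := by
  rw [weighted, norm_mul, Complex.norm_of_nonneg (sobolevWeight_nonneg κ σ ξ)]

lemma weighted_weighted (f : G → ℂ) : weighted κ σ (weighted κ τ f) = weighted κ (σ + τ) f := by
  funext ξ
  rw [weighted, weighted, weighted, ← mul_assoc, ← Complex.ofReal_mul, sobolevWeight_mul]

lemma weighted_zero (f : G → ℂ) : weighted κ 0 f = f := by
  funext ξ
  simp [weighted, sobolevWeight_zero]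

end Weight

/-! ### Convolution and the tame product estimate -/

section Convolution

variable {G : Type*} [AddCommGroup G] [MeasurableSpace G] [MeasurableAdd₂ G] [MeasurableNeg G]
  {μ : Measure G} [SFinite μ] {U V W : G → ℂ}

lemma measurable_convolution (hU : Measurable U) (hV : Measurable V) :
    Measurable (U ⋆[mul ℂ ℂ, μ] V) := by
  refine (StronglyMeasurable.integral_prod_right (f := fun x y => mul ℂ ℂ (U y) (V (x - y)))
    (Measurable.stronglyMeasurable ?_)).measurable
  simp only [ContinuousLinearMap.mul_apply', Function.uncurry_def]
  fun_prop

omit [MeasurableAdd₂ G] [MeasurableNeg G] [SFinite μ] in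
lemma enorm_convolution_le (U V : G → ℂ) (x : G) :
    ‖(U ⋆[mul ℂ ℂ, μ] V) x‖ₑ ≤ ∫⁻ y, ‖U y‖ₑ * ‖V (x - y)‖ₑ ∂μ :=
  (enorm_integral_le_lintegral_enorm _).trans (by simp)

variable [μ.IsAddLeftInvariant] [μ.IsNegInvariant]

omit [SFinite μ] in
lemma integrable_mul_sub (hU : MemLp U 2 μ) (hV : MemLp V 2 μ) (x : G) :
    Integrable (fun y => U y * V (x - y)) μ :=
  hU.integrable_mul (hV.comp_measurePreserving (Measure.measurePreserving_sub_left μ x))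

omit [SFinite μ] in
lemma convolution_sub_left (hU : MemLp U 2 μ) (hV : MemLp V 2 μ) (hW : MemLp W 2 μ) :
    (U - V) ⋆[mul ℂ ℂ, μ] W = (U ⋆[mul ℂ ℂ, μ] W) - (V ⋆[mul ℂ ℂ, μ] W) := by
  funext x
  simp only [convolution, Pi.sub_apply, ContinuousLinearMap.mul_apply', sub_mul]
  exact integral_sub (integrable_mul_sub hU hW x) (integrable_mul_sub hV hW x)

omit [SFinite μ] in
lemma convolution_sub_right (hU : MemLp U 2 μ) (hV : MemLp V 2 μ) (hW : MemLp W 2 μ) :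
    U ⋆[mul ℂ ℂ, μ] (V - W) = (U ⋆[mul ℂ ℂ, μ] V) - (U ⋆[mul ℂ ℂ, μ] W) := by
  funext x
  simp only [convolution, Pi.sub_apply, ContinuousLinearMap.mul_apply', mul_sub]
  exact integral_sub (integrable_mul_sub hU hV x) (integrable_mul_sub hU hW x)

omit [SFinite μ] in
lemma convolution_hermitian (hU : ∀ᵐ ξ ∂μ, U (-ξ) = conj (U ξ))
    (hV : ∀ᵐ ξ ∂μ, V (-ξ) = conj (V ξ)) (x : G) :
    (U ⋆[mul ℂ ℂ, μ] V) (-x) = conj ((U ⋆[mul ℂ ℂ, μ] V) x) := by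
  simp only [convolution, ContinuousLinearMap.mul_apply', ← integral_conj]
  rw [← integral_neg_eq_self]
  refine integral_congr_ae ?_
  filter_upwards [hU, (Measure.measurePreserving_sub_left μ x).quasiMeasurePreserving.ae hV] with y h1 h2
  rw [h1, map_mul, ← h2]
  congr 2; abel

/-- The tame estimate `‖U * V‖_σ ≤ 2^σ (‖U‖_σ ‖V‖_{L¹} + ‖U‖_{L¹} ‖V‖_σ)` for `σ ≥ 0`. -/
lemma eLpNorm_weighted_convolution_le {κ : G →+ ℝ} (hκ : Measurable κ) {σ : ℝ} (hσ : 0 ≤ σ)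
    (hU : Measurable U) (hV : Measurable V) :
    eLpNorm (weighted κ σ (U ⋆[mul ℂ ℂ, μ] V)) 2 μ ≤
      ENNReal.ofReal (2 ^ σ) * (eLpNorm V 1 μ * eLpNorm (weighted κ σ U) 2 μ +
        eLpNorm U 1 μ * eLpNorm (weighted κ σ V) 2 μ) := by
  have hUσ := measurable_weighted σ hκ hU
  have hVσ := measurable_weighted σ hκ hV
  set f₁ : G → ℝ≥0∞ := fun x => ∫⁻ y, ‖V y‖ₑ * ‖weighted κ σ U (x - y)‖ₑ ∂μ
  set f₂ : G → ℝ≥0∞ := fun x => ∫⁻ y, ‖U y‖ₑ * ‖weighted κ σ V (x - y)‖ₑ ∂μ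
  have hf₁ : Measurable f₁ := Measurable.lintegral_prod_right' (f := fun z : G × G =>
    ‖V z.2‖ₑ * ‖weighted κ σ U (z.1 - z.2)‖ₑ) (by fun_prop)
  have hf₂ : Measurable f₂ := Measurable.lintegral_prod_right' (f := fun z : G × G =>
    ‖U z.2‖ₑ * ‖weighted κ σ V (z.1 - z.2)‖ₑ) (by fun_prop)
  have hpt : ∀ x, ‖weighted κ σ (U ⋆[mul ℂ ℂ, μ] V) x‖ₑ ≤
      ENNReal.ofReal (2 ^ σ) * (f₁ x + f₂ x) := by
    intro x
    calc ‖weighted κ σ (U ⋆[mul ℂ ℂ, μ] V) x‖ₑ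
        ≤ ENNReal.ofReal (sobolevWeight κ σ x) * ∫⁻ y, ‖U y‖ₑ * ‖V (x - y)‖ₑ ∂μ := by
          rw [enorm_weighted]; gcongr; exact enorm_convolution_le U V x
      _ = ∫⁻ y, ENNReal.ofReal (sobolevWeight κ σ x) * (‖U y‖ₑ * ‖V (x - y)‖ₑ) ∂μ :=
          (lintegral_const_mul _ (by fun_prop)).symm
      _ ≤ ∫⁻ y, ENNReal.ofReal (2 ^ σ) * (‖V (x - y)‖ₑ * ‖weighted κ σ U y‖ₑ +
            ‖U y‖ₑ * ‖weighted κ σ V (x - y)‖ₑ) ∂μ := by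
          refine lintegral_mono fun y => ?_
          have h := ENNReal.ofReal_le_ofReal (sobolevWeight_le_add κ hσ x y)
          rw [ENNReal.ofReal_mul (by positivity), ENNReal.ofReal_add
            (sobolevWeight_nonneg _ _ _) (sobolevWeight_nonneg _ _ _)] at h
          refine (mul_le_mul_left h _).trans_eq ?_
          rw [enorm_weighted, enorm_weighted]
          ring
      _ = ENNReal.ofReal (2 ^ σ) * (f₁ x + f₂ x) := by
          rw [lintegral_const_mul _ (by fun_prop), lintegral_add_left (by fun_prop)]
          congr 2
          -- The substitution `y ↦ x - y` exchanges the two factors, so that the weighted one is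
          -- again the translated one.
          rw [← lintegral_sub_left_eq_self _ x]
          simp [f₁]
  calc eLpNorm (weighted κ σ (U ⋆[mul ℂ ℂ, μ] V)) 2 μ
      ≤ eLpNorm (fun x => ENNReal.ofReal (2 ^ σ) * (f₁ x + f₂ x)) 2 μ :=
        eLpNorm_mono_enorm hpt
    _ = ENNReal.ofReal (2 ^ σ) * eLpNorm (fun x => f₁ x + f₂ x) 2 μ := by
        simp only [eLpNorm_eq_lintegral_rpow_enorm_toReal (two_ne_zero) ENNReal.ofNat_ne_top,
          enorm_eq_self, ENNReal.toReal_ofNat, ENNReal.rpow_two, mul_pow]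
        rw [lintegral_const_mul _ (by fun_prop), ENNReal.mul_rpow_of_nonneg _ _ (by norm_num),
          ← ENNReal.rpow_natCast_mul]
        norm_num
    _ ≤ ENNReal.ofReal (2 ^ σ) * (eLpNorm f₁ 2 μ + eLpNorm f₂ 2 μ) := by
        gcongr
        exact eLpNorm_add_le hf₁.aestronglyMeasurable hf₂.aestronglyMeasurable (by norm_num)
    _ ≤ _ := by
        have h₁ : eLpNorm f₁ 2 μ ≤ eLpNorm V 1 μ * eLpNorm (weighted κ σ U) 2 μ := by
          refine (eLpNorm_lintegral_mul_sub_le hV.enorm hUσ.enorm).trans_eq ?_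
          rw [eLpNorm_one_eq_lintegral_enorm, eLpNorm_enorm]
        have h₂ : eLpNorm f₂ 2 μ ≤ eLpNorm U 1 μ * eLpNorm (weighted κ σ V) 2 μ := by
          refine (eLpNorm_lintegral_mul_sub_le hU.enorm hVσ.enorm).trans_eq ?_
          rw [eLpNorm_one_eq_lintegral_enorm, eLpNorm_enorm]
        exact mul_le_mul_right (add_le_add h₁ h₂) _

end Convolution

/-! ### The cubic cancellation `∫ u_x u² = 0` on the Fourier side -/

section Cubic

variable {G : Type*} [AddCommGroup G] [MeasurableSpace G] [MeasurableAdd₂ G] [MeasurableNeg G]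
  {μ : Measure G} [SFinite μ] [μ.IsAddLeftInvariant] [μ.IsNegInvariant]
  {κ : G →+ ℝ} {U : G → ℂ}

/-- The integrand `κ(x) Û(-x) Û(y) Û(x - y)` of the trilinear form `∫ u_x u²`. -/
def cubicIntegrand (κ : G →+ ℝ) (U : G → ℂ) (z : G × G) : ℂ :=
  κ z.1 * U (-z.1) * (U z.2 * U (z.1 - z.2))

/-- Cauchy-Schwarz in `x`: `κ(x) U(-x)` is square integrable, and so is `|U| * |U|` by Young's
inequality. Integrability on the product is what permits the changes of variables and Fubini's
theorem below. -/
lemma integrable_cubicIntegrand (hκ : Measurable κ) (hU : Measurable U) (hU1 : MemLp U 1 μ)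
    (hU2 : MemLp U 2 μ) (hκU : MemLp (fun x => κ x * U x) 2 μ) :
    Integrable (cubicIntegrand κ U) (μ.prod μ) := by
  have hm : Measurable (cubicIntegrand κ U) := by unfold cubicIntegrand; fun_prop
  refine ⟨hm.aestronglyMeasurable, ?_⟩
  rw [hasFiniteIntegral_iff_enorm, lintegral_prod _ hm.enorm.aemeasurable]
  set c : G → ℝ≥0∞ := fun x => ∫⁻ y, ‖U y‖ₑ * ‖U (x - y)‖ₑ ∂μ
  have hc : Measurable c := Measurable.lintegral_prod_right' (f := fun z : G × G =>
    ‖U z.2‖ₑ * ‖U (z.1 - z.2)‖ₑ) (by fun_prop)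
  have hd : Measurable fun x => ‖(κ x : ℂ) * U (-x)‖ₑ := by fun_prop
  have h1 : ∀ x, ∫⁻ y, ‖cubicIntegrand κ U (x, y)‖ₑ ∂μ = ‖(κ x : ℂ) * U (-x)‖ₑ * c x := by
    intro x
    rw [← lintegral_const_mul _ (by fun_prop)]
    simp only [cubicIntegrand, enorm_mul]
  simp_rw [h1]
  have h2 := ENNReal.lintegral_mul_le_Lp_mul_Lq μ Real.HolderConjugate.two_two
    hd.aemeasurable hc.aemeasurable
  refine h2.trans_lt (ENNReal.mul_lt_top ?_ ?_)
  · have h3 : MemLp (fun x => (κ x : ℂ) * U (-x)) 2 μ := by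
      convert! (hκU.comp_measurePreserving (Measure.measurePreserving_neg μ)).neg using 2 with x
      simp
    have := h3.2
    rw [eLpNorm_eq_lintegral_rpow_enorm_toReal two_ne_zero ENNReal.ofNat_ne_top] at this
    simpa using this
  · have h4 : eLpNorm c 2 μ < ∞ := by
      refine (eLpNorm_lintegral_mul_sub_le hU.enorm hU.enorm).trans_lt (ENNReal.mul_lt_top ?_ ?_)
      · rw [← eLpNorm_one_eq_lintegral_enorm]; exact hU1.2
      · rw [eLpNorm_enorm]; exact hU2.2
    rw [eLpNorm_eq_lintegral_rpow_enorm_toReal two_ne_zero ENNReal.ofNat_ne_top] at h4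
    simpa using h4

/-- The product `U(-x) U(y) U(x - y)` is symmetric in three frequencies of sum zero. Let `Φ` carry
the weight `κ(x)` and `Ψ` the weight `κ(y)`. The map `(x, y) ↦ (-y, -x)` gives `∫ Ψ = -∫ Φ`, and `y
↦ x - y` gives `∫ Ψ = ∫ Φ - ∫ Ψ`. Together these force `∫ Φ = 0`. -/
lemma integral_cubicIntegrand_eq_zero (hκ : Measurable κ) (hU : Measurable U) (hU1 : MemLp U 1 μ)
    (hU2 : MemLp U 2 μ) (hκU : MemLp (fun x => κ x * U x) 2 μ) :
    ∫ z, cubicIntegrand κ U z ∂(μ.prod μ) = 0 := by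
  have hΦ := integrable_cubicIntegrand hκ hU hU1 hU2 hκU
  set Ψ : G × G → ℂ := fun z => κ z.2 * U (-z.1) * (U z.2 * U (z.1 - z.2)) with hΨ
  have hΨm : Measurable Ψ := by fun_prop
  have hneg := Measure.measurePreserving_neg μ
  have hS : MeasurePreserving (fun z : G × G => (-z.2, -z.1)) (μ.prod μ) (μ.prod μ) :=
    (hneg.prod hneg).comp Measure.measurePreserving_swap
  have hT : MeasurePreserving (fun z : G × G => (z.1, z.1 - z.2)) (μ.prod μ) (μ.prod μ) := by
    have h := (measurePreserving_prod_add μ μ).comp ((MeasurePreserving.id μ).prod hneg)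
    simpa [Function.comp_def, sub_eq_add_neg] using h
  have hSΨ : ∀ z : G × G, Ψ z = -cubicIntegrand κ U (-z.2, -z.1) := fun z => by
    simp only [hΨ, cubicIntegrand, map_neg, neg_neg, Complex.ofReal_neg]
    rw [show -z.2 - -z.1 = z.1 - z.2 by abel]
    ring
  have hTΨ : ∀ z : G × G, Ψ (z.1, z.1 - z.2) = cubicIntegrand κ U z - Ψ z := fun z => by
    simp only [hΨ, cubicIntegrand, map_sub, sub_sub_cancel, Complex.ofReal_sub]
    ring
  have hΨi : Integrable Ψ (μ.prod μ) := by
    have := (hS.integrable_comp_of_integrable hΦ).neg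
    refine this.congr (Eventually.of_forall fun z => (hSΨ z).symm)
  have hI1 : ∫ z, Ψ z ∂(μ.prod μ) = -∫ z, cubicIntegrand κ U z ∂(μ.prod μ) := by
    simp_rw [hSΨ]
    rw [integral_neg]
    congr 1
    rw [← integral_map (φ := fun z : G × G => (-z.2, -z.1)) hS.aemeasurable
      (hS.map_eq.symm ▸ hΦ.aestronglyMeasurable), hS.map_eq]
  have hI2 : ∫ z, Ψ z ∂(μ.prod μ) =
      ∫ z, cubicIntegrand κ U z ∂(μ.prod μ) - ∫ z, Ψ z ∂(μ.prod μ) := by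
    rw [← integral_sub hΦ hΨi]
    simp_rw [← hTΨ]
    rw [← integral_map (φ := fun z : G × G => (z.1, z.1 - z.2)) hT.aemeasurable
      (hT.map_eq.symm ▸ hΨi.aestronglyMeasurable), hT.map_eq]
  linear_combination (2 / 3 : ℂ) * hI1 - (1 / 3 : ℂ) * hI2

/-- Hermitian symmetry, i.e. reality of `u`, enters only to replace `U(-x)` by `conj (U x)`, the
form in which the energy produces the integral. -/
lemma integral_mul_conj_mul_convolution_eq_zero (hκ : Measurable κ) (hU : Measurable U)
    (hU1 : MemLp U 1 μ) (hU2 : MemLp U 2 μ) (hκU : MemLp (fun x => κ x * U x) 2 μ)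
    (hH : ∀ᵐ ξ ∂μ, U (-ξ) = conj (U ξ)) :
    ∫ x, κ x * conj (U x) * (U ⋆[mul ℂ ℂ, μ] U) x ∂μ = 0 := by
  rw [← integral_cubicIntegrand_eq_zero hκ hU hU1 hU2 hκU,
    integral_prod _ (integrable_cubicIntegrand hκ hU hU1 hU2 hκU)]
  refine integral_congr_ae ?_
  filter_upwards [hH] with x hx
  simp only [cubicIntegrand, convolution, ContinuousLinearMap.mul_apply']
  rw [integral_const_mul, hx]

end Cubic

/-! ### Fourier multipliers and Hermitian functions -/

section Multiplier

variable {G : Type*} [MeasurableSpace G] {μ : Measure G}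

/-- Multiplication by a bounded function on `L²`. -/
def multiplier {m : G → ℂ} (hm : MemLp m ∞ μ) : Lp ℂ 2 μ →L[ℝ] Lp ℂ 2 μ :=
  ((mul ℂ ℂ).holderL μ ∞ 2 2 (hm.toLp m)).restrictScalars ℝ

lemma coeFn_multiplier {m : G → ℂ} (hm : MemLp m ∞ μ) (g : Lp ℂ 2 μ) :
    multiplier hm g =ᵐ[μ] fun ξ => m ξ * g ξ := by
  have h := (mul ℂ ℂ).coeFn_holder (r := 2) (hm.toLp m) g
  filter_upwards [h, hm.coeFn_toLp] with ξ h1 h2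
  rw [← h2]
  exact h1

variable [AddCommGroup G] [MeasurableNeg G] [μ.IsNegInvariant]

variable (μ) in
/-- The square integrable functions with `g(-ξ) = conj (g ξ)`. -/
def hermitianSubmodule : Submodule ℝ (Lp ℂ 2 μ) :=
  LinearMap.ker (((Lp.compMeasurePreservingₗᵢ ℝ (Neg.neg : G → G)
    (Measure.measurePreserving_neg μ)).toContinuousLinearMap -
      (Complex.conjCLE : ℂ →L[ℝ] ℂ).compLpL 2 μ : Lp ℂ 2 μ →L[ℝ] Lp ℂ 2 μ) :
        Lp ℂ 2 μ →ₗ[ℝ] Lp ℂ 2 μ)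

lemma mem_hermitianSubmodule {g : Lp ℂ 2 μ} :
    g ∈ hermitianSubmodule μ ↔ ∀ᵐ ξ ∂μ, g (-ξ) = conj (g ξ) := by
  have h1 := Lp.coeFn_compMeasurePreserving g (Measure.measurePreserving_neg μ)
  have h2 := (Complex.conjCLE : ℂ →L[ℝ] ℂ).coeFn_compLpL g
  have h3 : g ∈ hermitianSubmodule μ ↔
      Lp.compMeasurePreserving Neg.neg (Measure.measurePreserving_neg μ) g =
        (Complex.conjCLE : ℂ →L[ℝ] ℂ).compLpL 2 μ g := by
    rw [hermitianSubmodule, LinearMap.mem_ker]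
    exact sub_eq_zero
  rw [h3, Lp.ext_iff]
  constructor
  · intro h
    filter_upwards [h, h1, h2] with ξ a b c
    rw [b, c] at a
    simpa using a
  · intro h
    filter_upwards [h, h1, h2] with ξ a b c
    rw [b, c]
    simpa using a

/-- As the kernel of a continuous map the subspace is closed; completeness is what Picard-Lindelöf
requires. -/
instance : CompleteSpace (hermitianSubmodule μ) := ContinuousLinearMap.completeSpace_ker _

end Multiplier

/-! ### Elliptic symbols and the energy on the Fourier side -/

section Model

variable {G : Type*} [AddCommGroup G] [MeasurableSpace G] {μ : Measure G}
  {κ : G →+ ℝ} {M : G → ℝ} {c₀ c₁ s c : ℝ}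

variable (μ κ M c₀ c₁) in
/-- `M` is an even symbol, comparable to `1 + κ²`. -/
structure IsEllipticSymbol : Prop where
  measurable_freq : Measurable κ
  measurable_symbol : Measurable M
  even : ∀ ξ, M (-ξ) = M ξ
  pos : 0 < c₀
  lower : ∀ ξ, c₀ * (1 + κ ξ ^ 2) ≤ M ξ
  upper : ∀ ξ, M ξ ≤ c₁ * (1 + κ ξ ^ 2)
  memLp_weight : MemLp (sobolevWeight κ (-1)) 2 μ

/-- The symbol `-i κ / M`. -/
def dispersionSymbol (κ : G →+ ℝ) (M : G → ℝ) (ξ : G) : ℂ := -Complex.I * ((κ ξ / M ξ : ℝ) : ℂ)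

/-- The symbol `√M (1 + κ²)^(-s/2)`. -/
def energySymbol (κ : G →+ ℝ) (M : G → ℝ) (s : ℝ) (ξ : G) : ℂ :=
  ((√(M ξ) * sobolevWeight κ (-s) ξ : ℝ) : ℂ)

namespace IsEllipticSymbol

lemma symbol_pos (h : IsEllipticSymbol μ κ M c₀ c₁) (ξ : G) : 0 < M ξ :=
  (mul_pos h.pos (by positivity)).trans_le (h.lower ξ)

lemma measurable_dispersionSymbol (h : IsEllipticSymbol μ κ M c₀ c₁) :
    Measurable (dispersionSymbol κ M) := by
  have := h.measurable_freq
  have := h.measurable_symbol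
  unfold dispersionSymbol
  fun_prop

lemma measurable_energySymbol (h : IsEllipticSymbol μ κ M c₀ c₁) :
    Measurable (energySymbol κ M s) := by
  have := measurable_sobolevWeight (-s) h.measurable_freq
  have := h.measurable_symbol
  unfold energySymbol
  fun_prop

lemma dispersionSymbol_neg (h : IsEllipticSymbol μ κ M c₀ c₁) (ξ : G) :
    dispersionSymbol κ M (-ξ) = conj (dispersionSymbol κ M ξ) := by
  simp [dispersionSymbol, h.even, neg_div]

/-- The gain of one derivative: `|κ| ≤ (1 + κ²)^(1/2)` is divided by `M ≥ c₀ (1 + κ²)`. -/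
lemma norm_dispersionSymbol_le (h : IsEllipticSymbol μ κ M c₀ c₁) (ξ : G) :
    ‖dispersionSymbol κ M ξ‖ ≤ c₀⁻¹ * sobolevWeight κ (-1) ξ := by
  have h1 : ‖dispersionSymbol κ M ξ‖ = |κ ξ| / M ξ := by
    simp [dispersionSymbol, abs_of_pos (h.symbol_pos ξ)]
  have h2 : sobolevWeight κ (-1) ξ * sobolevWeight κ 2 ξ = sobolevWeight κ 1 ξ := by
    rw [sobolevWeight_mul]; norm_num
  rw [h1, div_le_iff₀ (h.symbol_pos ξ)]
  calc |κ ξ| ≤ sobolevWeight κ (-1) ξ * (1 + κ ξ ^ 2) := by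
        rw [← sobolevWeight_two, h2]; exact abs_le_sobolevWeight_one κ ξ
    _ = c₀⁻¹ * sobolevWeight κ (-1) ξ * (c₀ * (1 + κ ξ ^ 2)) := by
        have := h.pos.ne'
        field_simp
    _ ≤ _ := by
        have := h.pos
        have := sobolevWeight_nonneg κ (-1) ξ
        gcongr
        exact h.lower ξ

lemma memLp_dispersionSymbol (h : IsEllipticSymbol μ κ M c₀ c₁) :
    MemLp (dispersionSymbol κ M) ∞ μ :=
  memLp_top_of_bound h.measurable_dispersionSymbol.aestronglyMeasurable c₀⁻¹
    (Eventually.of_forall fun ξ => (h.norm_dispersionSymbol_le ξ).trans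
      (mul_le_of_le_one_right (inv_nonneg.2 h.pos.le) (sobolevWeight_le_one κ ξ (by norm_num))))

lemma upper_nonneg (h : IsEllipticSymbol μ κ M c₀ c₁) : 0 ≤ c₁ := by
  have := ((h.symbol_pos 0).trans_le (h.upper 0)).le
  simpa using this

omit [MeasurableSpace G] in
lemma norm_energySymbol (ξ : G) :
    ‖energySymbol κ M s ξ‖ = √(M ξ) * sobolevWeight κ (-s) ξ := by
  rw [energySymbol, Complex.norm_of_nonneg]
  exact mul_nonneg (Real.sqrt_nonneg _) (sobolevWeight_nonneg _ _ _)

omit [MeasurableSpace G] in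
lemma sqrt_weight_two (ξ : G) : √(1 + κ ξ ^ 2) = sobolevWeight κ 1 ξ := by
  rw [Real.sqrt_eq_rpow, sobolevWeight]

lemma norm_energySymbol_le (h : IsEllipticSymbol μ κ M c₀ c₁) (hs : 1 ≤ s) (ξ : G) :
    ‖energySymbol κ M s ξ‖ ≤ √c₁ := by
  rw [norm_energySymbol]
  have h1 := sobolevWeight_nonneg κ (-s) ξ
  calc √(M ξ) * sobolevWeight κ (-s) ξ
      ≤ √(c₁ * (1 + κ ξ ^ 2)) * sobolevWeight κ (-s) ξ := by gcongr; exact h.upper ξ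
    _ = √c₁ * sobolevWeight κ (1 + -s) ξ := by
        rw [Real.sqrt_mul h.upper_nonneg, sqrt_weight_two, mul_assoc, sobolevWeight_mul]
    _ ≤ √c₁ := mul_le_of_le_one_right (Real.sqrt_nonneg _)
        (sobolevWeight_le_one κ ξ (by linarith))

/-- The energy dominates the `H¹` norm. Since `g` already carries the weight of order `s`, this norm
of `u` appears as the weight of order `1 - s` on `g`. -/
lemma le_norm_energySymbol (h : IsEllipticSymbol μ κ M c₀ c₁) (ξ : G) :
    √c₀ * sobolevWeight κ (1 - s) ξ ≤ ‖energySymbol κ M s ξ‖ := by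
  rw [norm_energySymbol, sub_eq_add_neg, ← sobolevWeight_mul, ← mul_assoc, ← sqrt_weight_two,
    ← Real.sqrt_mul h.pos.le]
  have := sobolevWeight_nonneg κ (-s) ξ
  gcongr
  exact h.lower ξ

lemma memLp_energySymbol (h : IsEllipticSymbol μ κ M c₀ c₁) (hs : 1 ≤ s) :
    MemLp (energySymbol κ M s) ∞ μ :=
  memLp_top_of_bound h.measurable_energySymbol.aestronglyMeasurable _
    (Eventually.of_forall (h.norm_energySymbol_le hs))

/-- The linear part of the equation, in the variable `g = (1 + κ²)^(s/2) û`. -/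
def linearPart (h : IsEllipticSymbol μ κ M c₀ c₁) : Lp ℂ 2 μ →L[ℝ] Lp ℂ 2 μ :=
  multiplier h.memLp_dispersionSymbol

/-- The map `g ↦ √M û`, whose squared norm is the energy. -/
def energyMap (h : IsEllipticSymbol μ κ M c₀ c₁) (hs : 1 ≤ s) : Lp ℂ 2 μ →L[ℝ] Lp ℂ 2 μ :=
  multiplier (h.memLp_energySymbol hs)

lemma memLp_weighted (h : IsEllipticSymbol μ κ M c₀ c₁) {τ : ℝ} (hτ : τ ≤ 0) (g : Lp ℂ 2 μ) :
    MemLp (weighted κ τ g) 2 μ := by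
  refine (Lp.memLp g).of_le
    (measurable_weighted τ h.measurable_freq (Lp.stronglyMeasurable g).measurable
      ).aestronglyMeasurable (Eventually.of_forall fun ξ => ?_)
  rw [norm_weighted]
  exact mul_le_of_le_one_left (norm_nonneg _) (sobolevWeight_le_one κ ξ hτ)

lemma eLpNorm_weighted_le {τ : ℝ} (hτ : τ ≤ 0) (g : Lp ℂ 2 μ) :
    eLpNorm (weighted κ τ g) 2 μ ≤ ‖g‖ₑ := by
  rw [Lp.enorm_def]
  refine eLpNorm_mono fun ξ => ?_
  rw [norm_weighted]
  exact mul_le_of_le_one_left (norm_nonneg _) (sobolevWeight_le_one κ ξ hτ)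

lemma eLpNorm_weighted_le_energyMap (h : IsEllipticSymbol μ κ M c₀ c₁) (hs : 1 ≤ s)
    (g : Lp ℂ 2 μ) : eLpNorm (weighted κ (1 - s) g) 2 μ ≤
      ENNReal.ofReal (√c₀)⁻¹ * ‖h.energyMap hs g‖ₑ := by
  rw [Lp.enorm_def]
  refine eLpNorm_le_mul_eLpNorm_of_ae_le_mul ?_ 2
  filter_upwards [coeFn_multiplier (h.memLp_energySymbol hs) g] with ξ hξ
  have h0 : 0 < √c₀ := Real.sqrt_pos.2 h.pos
  rw [energyMap, hξ, norm_weighted, norm_mul, ← mul_assoc]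
  gcongr
  rw [inv_mul_eq_div, le_div_iff₀ h0, mul_comm]
  exact h.le_norm_energySymbol ξ

/-- The embedding of `H¹` into functions with integrable transform: Cauchy-Schwarz after splitting
off `(1 + κ²)^(-1/2)`, whose square integrability is the field `memLp_weight`. -/
lemma eLpNorm_weighted_one_le (h : IsEllipticSymbol μ κ M c₀ c₁) (g : Lp ℂ 2 μ) :
    eLpNorm (weighted κ (-s) g) 1 μ ≤
      eLpNorm (sobolevWeight κ (-1)) 2 μ * eLpNorm (weighted κ (1 - s) g) 2 μ := by
  have hw := measurable_sobolevWeight (-1) h.measurable_freq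
  have hg := measurable_weighted (1 - s) h.measurable_freq (Lp.stronglyMeasurable g).measurable
  have h1 := eLpNorm_smul_le_mul_eLpNorm (p := 2) (q := 2) (r := 1) (μ := μ)
    hg.aestronglyMeasurable hw.aestronglyMeasurable
  refine le_trans (le_of_eq ?_) h1
  congr 1
  funext ξ
  have h2 := congrFun (weighted_weighted κ (-1) (1 - s) (g : G → ℂ)) ξ
  rw [show -1 + (1 - s) = -s by ring] at h2
  rw [← h2]
  simp [weighted]

lemma memLp_one_weighted (h : IsEllipticSymbol μ κ M c₀ c₁) (hs : 1 ≤ s) (g : Lp ℂ 2 μ) :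
    MemLp (weighted κ (-s) g) 1 μ :=
  ⟨(measurable_weighted _ h.measurable_freq (Lp.stronglyMeasurable g).measurable
    ).aestronglyMeasurable, (h.eLpNorm_weighted_one_le g).trans_lt
      (ENNReal.mul_lt_top h.memLp_weight.2 (h.memLp_weighted (by linarith) g).2)⟩

/-- This is `u_x ∈ L²`, needed for the cubic cancellation. -/
lemma memLp_freq_mul_weighted (h : IsEllipticSymbol μ κ M c₀ c₁) (hs : 1 ≤ s) (g : Lp ℂ 2 μ) :
    MemLp (fun ξ => κ ξ * weighted κ (-s) g ξ) 2 μ := by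
  have hm := measurable_weighted (-s) h.measurable_freq (Lp.stronglyMeasurable g).measurable
  have hκ := h.measurable_freq
  refine (h.memLp_weighted (τ := 1 + -s) (by linarith) g).of_le
    (Measurable.aestronglyMeasurable (by fun_prop)) (Eventually.of_forall fun ξ => ?_)
  rw [← weighted_weighted, norm_weighted κ 1, norm_mul, Complex.norm_real, Real.norm_eq_abs]
  gcongr
  exact abs_le_sobolevWeight_one κ ξ

end IsEllipticSymbol

/-! ### The bilinear estimate -/

section Nonlinear

variable [MeasurableAdd₂ G] [MeasurableNeg G] [SFinite μ]

/-- The bilinear term `(1 + κ²)^(s/2) (-i κ / M) (û₁ * û₂)`, where `gⱼ = (1 + κ²)^(s/2) ûⱼ`. -/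
def bilinearTerm (μ : Measure G) (κ : G →+ ℝ) (M : G → ℝ) (s : ℝ) (g₁ g₂ : G → ℂ) : G → ℂ :=
  weighted κ s fun ξ => dispersionSymbol κ M ξ *
    (weighted κ (-s) g₁ ⋆[mul ℂ ℂ, μ] weighted κ (-s) g₂) ξ

namespace IsEllipticSymbol

/-- The constant in the bilinear estimate. -/
def bilinearConst (μ : Measure G) (κ : G →+ ℝ) (c₀ s : ℝ) : ℝ :=
  c₀⁻¹ * (2 ^ (s - 1) * ((eLpNorm (sobolevWeight κ (-1)) 2 μ).toReal * (√c₀)⁻¹))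

omit [MeasurableAdd₂ G] [MeasurableNeg G] [SFinite μ] in
lemma bilinearConst_nonneg (h : IsEllipticSymbol μ κ M c₀ c₁) : 0 ≤ bilinearConst μ κ c₀ s := by
  have := h.pos
  unfold bilinearConst
  positivity

lemma measurable_bilinearTerm (h : IsEllipticSymbol μ κ M c₀ c₁) (g₁ g₂ : Lp ℂ 2 μ) :
    Measurable (bilinearTerm μ κ M s g₁ g₂) := by
  have hκ := h.measurable_freq
  refine measurable_weighted _ hκ (h.measurable_dispersionSymbol.mul (measurable_convolution ?_ ?_))
  · exact measurable_weighted _ hκ (Lp.stronglyMeasurable g₁).measurable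
  · exact measurable_weighted _ hκ (Lp.stronglyMeasurable g₂).measurable

variable [μ.IsAddLeftInvariant] [μ.IsNegInvariant]

/-- The dispersion symbol lowers the weight from `s` to `s - 1 ≥ 0`, where the tame estimate
applies; its `L¹` norms are bounded by the energy. The factors of the constant come, in order, from
the gain of a derivative, the splitting of the weight, the embedding into `L¹` and the lower bound
on the energy. Each term is linear in a full norm, the other factor being an energy norm. -/
lemma eLpNorm_bilinearTerm_le (h : IsEllipticSymbol μ κ M c₀ c₁) (hs : 1 ≤ s)
    (g₁ g₂ : Lp ℂ 2 μ) : eLpNorm (bilinearTerm μ κ M s g₁ g₂) 2 μ ≤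
      ENNReal.ofReal (bilinearConst μ κ c₀ s) *
        (‖h.energyMap hs g₂‖ₑ * ‖g₁‖ₑ + ‖h.energyMap hs g₁‖ₑ * ‖g₂‖ₑ) := by
  have hκ := h.measurable_freq
  have hm : ∀ g : Lp ℂ 2 μ, Measurable (weighted κ (-s) g) := fun g =>
    measurable_weighted _ hκ (Lp.stronglyMeasurable g).measurable
  set K := eLpNorm (sobolevWeight κ (-1)) 2 μ with hK
  have hKtop : K ≠ ∞ := h.memLp_weight.2.ne
  set D := ENNReal.ofReal (√c₀)⁻¹
  have h1 : ∀ g : Lp ℂ 2 μ, eLpNorm (weighted κ (-s) g) 1 μ ≤ K * (D * ‖h.energyMap hs g‖ₑ) :=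
    fun g => (h.eLpNorm_weighted_one_le g).trans
      (mul_le_mul_right (h.eLpNorm_weighted_le_energyMap hs g) _)
  have h2 : ∀ g : Lp ℂ 2 μ, eLpNorm (weighted κ (s - 1) (weighted κ (-s) g)) 2 μ ≤ ‖g‖ₑ := by
    intro g
    rw [weighted_weighted]
    exact eLpNorm_weighted_le (by linarith) g
  calc eLpNorm (bilinearTerm μ κ M s g₁ g₂) 2 μ
      ≤ ENNReal.ofReal c₀⁻¹ * eLpNorm (weighted κ (s - 1)
          (weighted κ (-s) g₁ ⋆[mul ℂ ℂ, μ] weighted κ (-s) g₂)) 2 μ := by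
        refine eLpNorm_le_mul_eLpNorm_of_ae_le_mul (Eventually.of_forall fun ξ => ?_) 2
        rw [bilinearTerm, norm_weighted, norm_weighted, norm_mul, ← mul_assoc, ← mul_assoc]
        refine mul_le_mul_of_nonneg_right ?_ (norm_nonneg _)
        calc sobolevWeight κ s ξ * ‖dispersionSymbol κ M ξ‖
            ≤ sobolevWeight κ s ξ * (c₀⁻¹ * sobolevWeight κ (-1) ξ) :=
              mul_le_mul_of_nonneg_left (h.norm_dispersionSymbol_le ξ)
                (sobolevWeight_nonneg κ s ξ)
          _ = c₀⁻¹ * sobolevWeight κ (s - 1) ξ := by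
              rw [sub_eq_add_neg, ← sobolevWeight_mul]; ring
    _ ≤ ENNReal.ofReal c₀⁻¹ * (ENNReal.ofReal (2 ^ (s - 1)) *
          (K * (D * ‖h.energyMap hs g₂‖ₑ) * ‖g₁‖ₑ + K * (D * ‖h.energyMap hs g₁‖ₑ) * ‖g₂‖ₑ)) := by
        refine mul_le_mul_right ((eLpNorm_weighted_convolution_le hκ (by linarith) (hm g₁)
          (hm g₂)).trans (mul_le_mul_right ?_ _)) _
        exact add_le_add (mul_le_mul' (h1 g₂) (h2 g₁)) (mul_le_mul' (h1 g₁) (h2 g₂))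
    _ = _ := by
        have : ENNReal.ofReal (bilinearConst μ κ c₀ s) =
            ENNReal.ofReal c₀⁻¹ * (ENNReal.ofReal (2 ^ (s - 1)) * (K * D)) := by
          have := h.pos
          rw [bilinearConst, ENNReal.ofReal_mul (by positivity), ENNReal.ofReal_mul (by positivity),
            ENNReal.ofReal_mul (by positivity), ENNReal.ofReal_toReal hKtop]
        rw [this]
        ring

lemma memLp_bilinearTerm (h : IsEllipticSymbol μ κ M c₀ c₁) (hs : 1 ≤ s) (g₁ g₂ : Lp ℂ 2 μ) :
    MemLp (bilinearTerm μ κ M s g₁ g₂) 2 μ := by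
  refine ⟨(h.measurable_bilinearTerm g₁ g₂).aestronglyMeasurable,
    (h.eLpNorm_bilinearTerm_le hs g₁ g₂).trans_lt ?_⟩
  finiteness

/-- The bilinear term as an element of `L²`. -/
def bilinearPart (h : IsEllipticSymbol μ κ M c₀ c₁) (hs : 1 ≤ s) (g₁ g₂ : Lp ℂ 2 μ) : Lp ℂ 2 μ :=
  (h.memLp_bilinearTerm hs g₁ g₂).toLp _

lemma coeFn_bilinearPart (h : IsEllipticSymbol μ κ M c₀ c₁) (hs : 1 ≤ s) (g₁ g₂ : Lp ℂ 2 μ) :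
    h.bilinearPart hs g₁ g₂ =ᵐ[μ] bilinearTerm μ κ M s g₁ g₂ :=
  (h.memLp_bilinearTerm hs g₁ g₂).coeFn_toLp

lemma norm_bilinearPart_le (h : IsEllipticSymbol μ κ M c₀ c₁) (hs : 1 ≤ s) (g₁ g₂ : Lp ℂ 2 μ) :
    ‖h.bilinearPart hs g₁ g₂‖ ≤ bilinearConst μ κ c₀ s *
      (‖h.energyMap hs g₂‖ * ‖g₁‖ + ‖h.energyMap hs g₁‖ * ‖g₂‖) := by
  have h1 := h.eLpNorm_bilinearTerm_le hs g₁ g₂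
  rw [← Lp.enorm_toLp (hf := h.memLp_bilinearTerm hs g₁ g₂)] at h1
  simp only [← ofReal_norm] at h1
  have := h.bilinearConst_nonneg (s := s)
  rw [← ENNReal.ofReal_mul (by positivity), ← ENNReal.ofReal_mul (by positivity),
    ← ENNReal.ofReal_add (by positivity) (by positivity), ← ENNReal.ofReal_mul (by positivity),
    ENNReal.ofReal_le_ofReal_iff (by positivity)] at h1
  exact h1

omit [MeasurableAdd₂ G] [MeasurableNeg G] [SFinite μ] [μ.IsAddLeftInvariant]
  [μ.IsNegInvariant] in
lemma weighted_coeFn_sub (τ : ℝ) (g₁ g₂ : Lp ℂ 2 μ) :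
    weighted κ τ ↑(g₁ - g₂) =ᵐ[μ] weighted κ τ g₁ - weighted κ τ g₂ := by
  filter_upwards [Lp.coeFn_sub g₁ g₂] with ξ hξ
  simp only [weighted, hξ, Pi.sub_apply, mul_sub]

lemma bilinearPart_sub_left (h : IsEllipticSymbol μ κ M c₀ c₁) (hs : 1 ≤ s)
    (g₁ g₂ g : Lp ℂ 2 μ) : h.bilinearPart hs (g₁ - g₂) g =
      h.bilinearPart hs g₁ g - h.bilinearPart hs g₂ g := by
  have hm := fun g : Lp ℂ 2 μ => h.memLp_weighted (τ := -s) (by linarith) g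
  refine Lp.ext ?_
  filter_upwards [h.coeFn_bilinearPart hs (g₁ - g₂) g, h.coeFn_bilinearPart hs g₁ g,
    h.coeFn_bilinearPart hs g₂ g, Lp.coeFn_sub (h.bilinearPart hs g₁ g) (h.bilinearPart hs g₂ g)]
    with ξ e1 e2 e3 e4
  rw [e4, Pi.sub_apply, e1, e2, e3]
  have : weighted κ (-s) ↑(g₁ - g₂) ⋆[mul ℂ ℂ, μ] weighted κ (-s) g =
      (weighted κ (-s) g₁ - weighted κ (-s) g₂) ⋆[mul ℂ ℂ, μ] weighted κ (-s) g :=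
    convolution_congr _ (weighted_coeFn_sub _ g₁ g₂) (ae_eq_refl _)
  simp only [bilinearTerm, this, convolution_sub_left (hm g₁) (hm g₂) (hm g), weighted,
    Pi.sub_apply]
  ring

lemma bilinearPart_sub_right (h : IsEllipticSymbol μ κ M c₀ c₁) (hs : 1 ≤ s)
    (g g₁ g₂ : Lp ℂ 2 μ) : h.bilinearPart hs g (g₁ - g₂) =
      h.bilinearPart hs g g₁ - h.bilinearPart hs g g₂ := by
  have hm := fun g : Lp ℂ 2 μ => h.memLp_weighted (τ := -s) (by linarith) g
  refine Lp.ext ?_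
  filter_upwards [h.coeFn_bilinearPart hs g (g₁ - g₂), h.coeFn_bilinearPart hs g g₁,
    h.coeFn_bilinearPart hs g g₂, Lp.coeFn_sub (h.bilinearPart hs g g₁) (h.bilinearPart hs g g₂)]
    with ξ e1 e2 e3 e4
  rw [e4, Pi.sub_apply, e1, e2, e3]
  have : weighted κ (-s) g ⋆[mul ℂ ℂ, μ] weighted κ (-s) ↑(g₁ - g₂) =
      weighted κ (-s) g ⋆[mul ℂ ℂ, μ] (weighted κ (-s) g₁ - weighted κ (-s) g₂) :=
    convolution_congr _ (ae_eq_refl _) (weighted_coeFn_sub _ g₁ g₂)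
  simp only [bilinearTerm, this, convolution_sub_right (hm g) (hm g₁) (hm g₂), weighted,
    Pi.sub_apply]
  ring

end IsEllipticSymbol
end Nonlinear
end Model

/-! ### The vector field on the Fourier side -/

section ModelField

variable {G : Type*} [AddCommGroup G] [MeasurableSpace G] [MeasurableAdd₂ G] [MeasurableNeg G]
  {μ : Measure G} [SFinite μ] [μ.IsAddLeftInvariant] [μ.IsNegInvariant]
  {κ : G →+ ℝ} {M : G → ℝ} {c₀ c₁ s : ℝ}

namespace IsEllipticSymbol

omit [MeasurableAdd₂ G] [SFinite μ] [μ.IsAddLeftInvariant] in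
lemma linearPart_mem (h : IsEllipticSymbol μ κ M c₀ c₁) {g : Lp ℂ 2 μ}
    (hg : g ∈ hermitianSubmodule μ) : h.linearPart g ∈ hermitianSubmodule μ := by
  rw [mem_hermitianSubmodule] at hg ⊢
  have h1 := coeFn_multiplier h.memLp_dispersionSymbol g
  have h2 := (Measure.measurePreserving_neg μ).quasiMeasurePreserving.ae h1
  filter_upwards [hg, h1, h2] with ξ e e1 e2
  rw [linearPart, e1, e2, e, h.dispersionSymbol_neg, map_mul]

omit [MeasurableAdd₂ G] [SFinite μ] [μ.IsAddLeftInvariant] in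
lemma weighted_hermitian {g : Lp ℂ 2 μ} (hg : g ∈ hermitianSubmodule μ) (τ : ℝ) :
    ∀ᵐ ξ ∂μ, weighted κ τ g (-ξ) = conj (weighted κ τ g ξ) := by
  filter_upwards [mem_hermitianSubmodule.1 hg] with ξ e
  rw [weighted, weighted, e, sobolevWeight_neg_apply, map_mul, Complex.conj_ofReal]

lemma bilinearPart_mem (h : IsEllipticSymbol μ κ M c₀ c₁) (hs : 1 ≤ s) {g : Lp ℂ 2 μ}
    (hg : g ∈ hermitianSubmodule μ) : h.bilinearPart hs g g ∈ hermitianSubmodule μ := by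
  have hU := weighted_hermitian (κ := κ) hg (-s)
  rw [mem_hermitianSubmodule]
  have h1 := h.coeFn_bilinearPart hs g g
  have h2 := (Measure.measurePreserving_neg μ).quasiMeasurePreserving.ae h1
  filter_upwards [h1, h2] with ξ e1 e2
  rw [e1, e2, bilinearTerm, weighted, weighted, convolution_hermitian hU hU,
    h.dispersionSymbol_neg, sobolevWeight_neg_apply, map_mul, map_mul, Complex.conj_ofReal]

/-- The equation `η_t = A (η - c η²)` for the variable `g = (1 + κ²)^(s/2) η̂`. -/
def modelField (h : IsEllipticSymbol μ κ M c₀ c₁) (hs : 1 ≤ s) (c : ℝ)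
    (g : hermitianSubmodule μ) : hermitianSubmodule μ :=
  ⟨h.linearPart g - c • h.bilinearPart hs g g, Submodule.sub_mem _ (h.linearPart_mem g.2)
    (Submodule.smul_mem _ c (h.bilinearPart_mem hs g.2))⟩

-- The dispersion symbol is purely imaginary, so the real inner product already vanishes pointwise.
omit [MeasurableAdd₂ G] [MeasurableNeg G] [SFinite μ] [μ.IsAddLeftInvariant]
  [μ.IsNegInvariant] in
lemma inner_energyMap_linearPart (h : IsEllipticSymbol μ κ M c₀ c₁) (hs : 1 ≤ s)
    (g : Lp ℂ 2 μ) : ⟪h.energyMap hs g, h.energyMap hs (h.linearPart g)⟫ = 0 := by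
  rw [L2.inner_def]
  refine integral_eq_zero_of_ae ?_
  filter_upwards [coeFn_multiplier h.memLp_dispersionSymbol g,
    coeFn_multiplier (h.memLp_energySymbol hs) g,
    coeFn_multiplier (h.memLp_energySymbol hs) (h.linearPart g)] with ξ e1 e2 e3
  have e4 : conj (energySymbol κ M s ξ * g ξ) *
      (energySymbol κ M s ξ * (dispersionSymbol κ M ξ * g ξ)) =
      ((‖energySymbol κ M s ξ * g ξ‖ ^ 2 * (κ ξ / M ξ) : ℝ) : ℂ) * -Complex.I := by
    have : ((‖energySymbol κ M s ξ * g ξ‖ ^ 2 : ℝ) : ℂ) =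
        conj (energySymbol κ M s ξ * g ξ) * (energySymbol κ M s ξ * g ξ) := by
      rw [← Complex.normSq_eq_norm_sq, Complex.normSq_eq_conj_mul_self]
    rw [Complex.ofReal_mul, this, dispersionSymbol]
    ring
  rw [energyMap, e2, e3, linearPart, e1, Complex.inner, mul_comm, e4,
    Complex.re_ofReal_mul]
  simp

/-- The energy is chosen so that `M` cancels the denominator of the dispersion symbol; what is left
is `-i κ conj(û) (û * û)`, whose integral is the cubic cancellation. -/
lemma inner_energyMap_bilinearPart (h : IsEllipticSymbol μ κ M c₀ c₁) (hs : 1 ≤ s)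
    {g : Lp ℂ 2 μ} (hg : g ∈ hermitianSubmodule μ) :
    ⟪h.energyMap hs g, h.energyMap hs (h.bilinearPart hs g g)⟫ = 0 := by
  set U := weighted κ (-s) g
  have hκ := h.measurable_freq
  have hUm : Measurable U := measurable_weighted _ hκ (Lp.stronglyMeasurable g).measurable
  have hcub := integral_mul_conj_mul_convolution_eq_zero hκ hUm (h.memLp_one_weighted hs g)
    (h.memLp_weighted (by linarith) g) (h.memLp_freq_mul_weighted hs g)
    (weighted_hermitian hg (-s))
  have hpt : ∀ᵐ ξ ∂μ, inner ℂ (h.energyMap hs g ξ) (h.energyMap hs (h.bilinearPart hs g g) ξ) =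
      -Complex.I * (κ ξ * conj (U ξ) * (U ⋆[mul ℂ ℂ, μ] U) ξ) := by
    filter_upwards [h.coeFn_bilinearPart hs g g, coeFn_multiplier (h.memLp_energySymbol hs) g,
      coeFn_multiplier (h.memLp_energySymbol hs) (h.bilinearPart hs g g)] with ξ e1 e2 e3
    have hM := h.symbol_pos ξ
    have hM' : (M ξ : ℂ) ≠ 0 := Complex.ofReal_ne_zero.2 hM.ne'
    have hsq : (√(M ξ) : ℂ) * (√(M ξ) : ℂ) = M ξ := by
      rw [← Complex.ofReal_mul, Real.mul_self_sqrt hM.le]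
    have hw : (sobolevWeight κ (-s) ξ : ℂ) * sobolevWeight κ s ξ = 1 := by
      rw [← Complex.ofReal_mul, sobolevWeight_mul, neg_add_cancel, sobolevWeight_zero,
        Complex.ofReal_one]
    rw [RCLike.inner_apply', energyMap, e2, e3, e1, bilinearTerm]
    change conj _ * (_ * (_ * (_ * (U ⋆[mul ℂ ℂ, μ] U) ξ))) = _
    have hUξ : conj (U ξ) = sobolevWeight κ (-s) ξ * conj (g ξ) := by
      simp [U, weighted]
    rw [hUξ]
    generalize (U ⋆[mul ℂ ℂ, μ] U) ξ = Q
    simp only [energySymbol, dispersionSymbol, map_mul, Complex.conj_ofReal,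
      Complex.ofReal_mul, Complex.ofReal_div]
    set w : ℂ := (sobolevWeight κ (-s) ξ : ℂ)
    set w' : ℂ := (sobolevWeight κ s ξ : ℂ)
    set r : ℂ := (√(M ξ) : ℂ)
    set N : ℂ := (M ξ : ℂ)
    calc _ = -Complex.I * ((w * w') * ((r * r) * (κ ξ / N)) * (w * conj (g ξ)) * Q) := by ring
      _ = _ := by rw [hw, hsq, mul_div_cancel₀ _ hM', one_mul]
  rw [L2.inner_def]
  have hre : ∀ᵐ ξ ∂μ, ⟪h.energyMap hs g ξ, h.energyMap hs (h.bilinearPart hs g g) ξ⟫ =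
      RCLike.re (inner ℂ (h.energyMap hs g ξ) (h.energyMap hs (h.bilinearPart hs g g) ξ)) :=
    Eventually.of_forall fun _ => rfl
  rw [integral_congr_ae hre, integral_re (L2.integrable_inner (𝕜 := ℂ) _ _),
    integral_congr_ae hpt, integral_const_mul, hcub]
  simp

/-- The growth bound keeps the energy norm in the bilinear estimate. For the Lipschitz bound it
suffices to replace that norm by a multiple of the full norm. -/
lemma modelField_isEnergyField (h : IsEllipticSymbol μ κ M c₀ c₁) (hs : 1 ≤ s) (c : ℝ) :
    IsEnergyField (h.modelField hs c) ((h.energyMap hs).comp (hermitianSubmodule μ).subtypeL)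
      (‖h.linearPart‖ + |c| * (2 * bilinearConst μ κ c₀ s)) where
  nonneg := by
    have := h.bilinearConst_nonneg (s := s)
    positivity
  energy u := by
    change ⟪h.energyMap hs u, h.energyMap hs (h.linearPart u - c • h.bilinearPart hs u u)⟫ = 0
    rw [map_sub, map_smul, inner_sub_right, inner_smul_right, h.inner_energyMap_linearPart,
      h.inner_energyMap_bilinearPart hs u.2, mul_zero, sub_zero]
  growth u := by
    have hC := h.bilinearConst_nonneg (s := s)
    change ‖h.linearPart u - c • h.bilinearPart hs u u‖ ≤
      _ * (1 + ‖h.energyMap hs (u : Lp ℂ 2 μ)‖) * ‖(u : Lp ℂ 2 μ)‖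
    set v : Lp ℂ 2 μ := u.1
    have h1 := h.linearPart.le_opNorm v
    have h2 := h.norm_bilinearPart_le hs v v
    have h3 : ‖c • h.bilinearPart hs v v‖ ≤
        |c| * (bilinearConst μ κ c₀ s * (‖h.energyMap hs v‖ * ‖v‖ + ‖h.energyMap hs v‖ * ‖v‖)) := by
      rw [norm_smul, Real.norm_eq_abs]; gcongr
    have h4 : 0 ≤ ‖h.linearPart‖ * ‖h.energyMap hs v‖ * ‖v‖ := by positivity
    have h5 : 0 ≤ |c| * (2 * bilinearConst μ κ c₀ s) * ‖v‖ := by positivity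
    nlinarith [norm_sub_le (h.linearPart v) (c • h.bilinearPart hs v v)]
  lipschitz R := by
    have hC := h.bilinearConst_nonneg (s := s)
    set D := bilinearConst μ κ c₀ s
    set E := ‖h.energyMap hs‖
    have hB : ∀ v w : Lp ℂ 2 μ, ‖h.bilinearPart hs v w‖ ≤ D * (2 * E) * (‖v‖ * ‖w‖) := by
      intro v w
      refine (h.norm_bilinearPart_le hs v w).trans ?_
      have hv := (h.energyMap hs).le_opNorm v
      have hw := (h.energyMap hs).le_opNorm w
      calc _ ≤ D * (E * ‖w‖ * ‖v‖ + E * ‖v‖ * ‖w‖) := by gcongr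
        _ = _ := by ring
    refine ⟨Real.toNNReal (‖h.linearPart‖ + |c| * (D * (2 * E) * (2 * R))),
      LipschitzOnWith.of_dist_le_mul fun u hu v hv => ?_⟩
    have hu' : ‖(u : Lp ℂ 2 μ)‖ ≤ R := by simpa using hu
    have hv' : ‖(v : Lp ℂ 2 μ)‖ ≤ R := by simpa using hv
    rw [dist_eq_norm, dist_eq_norm]
    change ‖(h.linearPart u - c • h.bilinearPart hs u u) -
      (h.linearPart v - c • h.bilinearPart hs v v)‖ ≤ _ * ‖(u : Lp ℂ 2 μ) - v‖
    set x : Lp ℂ 2 μ := u.1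
    set y : Lp ℂ 2 μ := v.1
    -- `B(x, x) - B(y, y) = B(x - y, x) + B(y, x - y)`, which needs no symmetry of `B`.
    have e1 : (h.linearPart x - c • h.bilinearPart hs x x) -
        (h.linearPart y - c • h.bilinearPart hs y y) = h.linearPart (x - y) -
          c • (h.bilinearPart hs (x - y) x + h.bilinearPart hs y (x - y)) := by
      rw [map_sub, h.bilinearPart_sub_left, h.bilinearPart_sub_right]
      module
    rw [e1]
    calc _ ≤ ‖h.linearPart (x - y)‖ +
          ‖c • (h.bilinearPart hs (x - y) x + h.bilinearPart hs y (x - y))‖ := norm_sub_le _ _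
      _ ≤ ‖h.linearPart‖ * ‖x - y‖ +
          |c| * (D * (2 * E) * (‖x - y‖ * R) + D * (2 * E) * (R * ‖x - y‖)) := by
          rw [norm_smul, Real.norm_eq_abs]
          gcongr
          · exact h.linearPart.le_opNorm _
          · refine (norm_add_le _ _).trans (add_le_add ((hB _ _).trans ?_) ((hB _ _).trans ?_))
            · gcongr
            · gcongr
      _ = (‖h.linearPart‖ + |c| * (D * (2 * E) * (2 * R))) * ‖x - y‖ := by ring
      _ ≤ _ := by gcongr; exact Real.le_coe_toNNReal _

theorem globallyWellPosed_modelField (h : IsEllipticSymbol μ κ M c₀ c₁) (hs : 1 ≤ s) (c : ℝ)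
    (φ : hermitianSubmodule μ) : GloballyWellPosed (h.modelField hs c) φ :=
  (h.modelField_isEnergyField hs c).globallyWellPosed φ

lemma continuous_modelField (h : IsEllipticSymbol μ κ M c₀ c₁) (hs : 1 ≤ s) (c : ℝ) :
    Continuous (h.modelField hs c) := by
  refine continuous_iff_continuousAt.2 fun u => ?_
  obtain ⟨K, hK⟩ := (h.modelField_isEnergyField hs c).lipschitz (‖u‖ + 1)
  refine hK.continuousOn.continuousAt (Metric.closedBall_mem_nhds_of_mem ?_)
  simp

end IsEllipticSymbol

end ModelField

/-! ### Transport of well-posedness along an isometry -/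

section Transport

variable {Y Z : Type*} [NormedAddCommGroup Y] [NormedSpace ℝ Y] [NormedAddCommGroup Z]
  [NormedSpace ℝ Z] {F : Z → Z} {φ : Z} {T : ℝ} {η : ℝ → Z}

lemma IsSolutionOn.map (Φ : Z ≃ₗᵢ[ℝ] Y) (hη : IsSolutionOn F φ T η) :
    IsSolutionOn (fun u => Φ (F (Φ.symm u))) (Φ φ) T (fun t => Φ (η t)) := by
  refine ⟨Φ.continuous.comp_continuousOn hη.continuousOn, congrArg Φ hη.init, fun t ht => ?_⟩
  have := Φ.toContinuousLinearEquiv.hasFDerivAt.comp_hasDerivWithinAt t (hη.hasDeriv t ht)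
  simpa [Function.comp_def] using this

lemma IsGlobalSolution.map (Φ : Z ≃ₗᵢ[ℝ] Y) (hη : IsGlobalSolution F φ η) :
    IsGlobalSolution (fun u => Φ (F (Φ.symm u))) (Φ φ) (fun t => Φ (η t)) := by
  refine ⟨Φ.continuous.comp hη.continuous, congrArg Φ hη.init, fun t => ?_⟩
  have := Φ.toContinuousLinearEquiv.hasFDerivAt.comp_hasDerivAt t (hη.hasDeriv t)
  simpa [Function.comp_def] using this

lemma GloballyWellPosed.map (Φ : Z ≃ₗᵢ[ℝ] Y) (h : GloballyWellPosed F φ) :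
    GloballyWellPosed (fun u => Φ (F (Φ.symm u))) (Φ φ) := by
  have hinv : (fun u => Φ.symm ((fun u => Φ (F (Φ.symm u))) (Φ.symm.symm u))) = F := by
    funext u; simp
  have back : ∀ {ψ : Y} {T : ℝ} {ζ : ℝ → Y}, IsSolutionOn (fun u => Φ (F (Φ.symm u))) ψ T ζ →
      IsSolutionOn F (Φ.symm ψ) T (fun t => Φ.symm (ζ t)) := fun hζ => by
    have := hζ.map Φ.symm
    rwa [hinv] at this
  have backG : ∀ {ψ : Y} {ζ : ℝ → Y}, IsGlobalSolution (fun u => Φ (F (Φ.symm u))) ψ ζ →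
      IsGlobalSolution F (Φ.symm ψ) (fun t => Φ.symm (ζ t)) := fun hζ => by
    have := hζ.map Φ.symm
    rwa [hinv] at this
  refine ⟨fun T hT => ?_, ?_⟩
  · obtain ⟨⟨η, hη⟩, huniq, hcont⟩ := h.wellPosedOn T hT
    refine ⟨⟨_, hη.map Φ⟩, fun η₁ η₂ h₁ h₂ t ht => ?_, fun φs φ' η' hφ hη' => ?_⟩
    · have h₁' := back h₁
      have h₂' := back h₂
      rw [Φ.symm_apply_apply] at h₁' h₂'
      exact Φ.symm.injective (huniq _ _ h₁' h₂' ht)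
    · obtain ⟨ηs, h1, h2⟩ := hcont (fun n => Φ.symm (φs n)) (Φ.symm φ') _
        ((Φ.symm.continuous.tendsto φ').comp hφ) (back hη')
      refine ⟨fun n t => Φ (ηs n t), h1.mono fun n hn => ?_, ?_⟩
      · simpa using hn.map Φ
      · have := Φ.isometry.uniformContinuous.comp_tendstoUniformlyOn h2
        simpa [Function.comp_def] using this
  · obtain ⟨η, hη, huniq⟩ := h.existsUnique
    refine ⟨_, hη.map Φ, fun ζ hζ => ?_⟩
    have hζ' := backG hζ
    rw [Φ.symm_apply_apply] at hζ'
    have := huniq _ hζ'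
    funext t
    rw [← this]
    simp

end Transport

/-! ### Bounds for the symbols -/

section Symbol

lemma symbolM_neg (j : Dispersion) (a b h k : ℝ) : symbolM j a b h (-k) = symbolM j a b h k := by
  cases j with
  | hilbert => simp [symbolM]
  | strip => simp [symbolM, Real.cosh_neg, Real.sinh_neg, div_neg]

lemma measurable_symbolM (j : Dispersion) (a b h : ℝ) : Measurable (symbolM j a b h) := by
  cases j with
  | hilbert => unfold symbolM; fun_prop
  | strip =>
      unfold symbolM
      refine Measurable.ite (measurableSet_singleton (0 : ℝ)) (by fun_prop) ?_
      fun_prop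

/-- From `cosh x = sinh x + e^(-x)` and `x e^(-x) ≤ x ≤ sinh x`. -/
lemma mul_cosh_div_sinh_le {x : ℝ} (hx : 0 < x) : x * (Real.cosh x / Real.sinh x) ≤ 1 + x := by
  have hs : 0 < Real.sinh x := Real.sinh_pos_iff.2 hx
  have h1 : x ≤ Real.sinh x := Real.self_le_sinh_iff.2 hx.le
  have h2 : Real.cosh x - Real.sinh x = Real.exp (-x) := Real.cosh_sub_sinh x
  have h3 : Real.exp (-x) ≤ 1 := Real.exp_le_one_iff.2 (by linarith)
  rw [mul_div_assoc', div_le_iff₀ hs]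
  nlinarith [mul_le_mul_of_nonneg_left h3 hx.le]

lemma symbolM_le (j : Dispersion) {a b h : ℝ} (ha : 0 < a) (hb : 0 < b) (hh : 0 < h) (k : ℝ) :
    symbolM j a b h k ≤ (1 + b / h + b + a) * (1 + k ^ 2) := by
  have hk1 : |k| ≤ 1 + k ^ 2 := by nlinarith [sq_abs k, sq_nonneg (|k| - 1), abs_nonneg k]
  have hbh : 0 < b / h := by positivity
  have hmain : 1 + b / h + b * |k| + a * k ^ 2 ≤ (1 + b / h + b + a) * (1 + k ^ 2) := by
    nlinarith [mul_le_mul_of_nonneg_left hk1 hb.le, mul_nonneg hbh.le (sq_nonneg k), sq_nonneg k]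
  refine le_trans ?_ hmain
  cases j with
  | hilbert => simp only [symbolM]; linarith
  | strip =>
      by_cases hk : k = 0
      · simp [symbolM, hk]
      -- The symbol is even. For `k > 0`, `x coth x ≤ 1 + x` at `x = h k` gives `b k coth(h k) ≤ b/h
      -- + b k`, the origin of the term `b/h` in the constant.
      · wlog hpos : 0 < k generalizing k with H
        · have := H (-k) (by simpa using hk1) (by simpa using hmain) (by simpa using hk)
            (by simpa using lt_of_le_of_ne (not_lt.1 hpos) hk)
          simpa [symbolM_neg] using this
        · have h1 := mul_cosh_div_sinh_le (mul_pos hh hpos)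
          have h2 : b * k * (Real.cosh (h * k) / Real.sinh (h * k)) =
              b / h * (h * k * (Real.cosh (h * k) / Real.sinh (h * k))) := by
            field_simp
          have h3 : b / h * (1 + h * k) = b / h + b * k := by field_simp
          simp only [symbolM, hk, if_false, abs_of_pos hpos]
          rw [h2]
          nlinarith [mul_le_mul_of_nonneg_left h1 hbh.le]

lemma min_mul_le_symbolM (j : Dispersion) {a b h : ℝ} (hb : 0 < b) (hh : 0 < h)
    (k : ℝ) : min 1 a * (1 + k ^ 2) ≤ symbolM j a b h k := by
  refine le_trans ?_ (le_symbolM j hb hh k)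
  nlinarith [min_le_left 1 a, mul_le_mul_of_nonneg_right (min_le_right 1 a) (sq_nonneg k)]

variable {G : Type*} [AddCommGroup G] [MeasurableSpace G] {μ : Measure G} {κ : G →+ ℝ}

/-- Both dispersions fit the model with the same constants; the domain matters only through the
integrability of `(1 + κ²)⁻¹`, the square of the weight of order `-1`. -/
lemma isEllipticSymbol_symbolM (j : Dispersion) {a b h : ℝ} (ha : 0 < a) (hb : 0 < b)
    (hh : 0 < h) (hκ : Measurable κ) (hint : Integrable (fun ξ => (1 + κ ξ ^ 2)⁻¹) μ) :
    IsEllipticSymbol μ κ (fun ξ => symbolM j a b h (κ ξ)) (min 1 a) (1 + b / h + b + a) where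
  measurable_freq := hκ
  measurable_symbol := (measurable_symbolM j a b h).comp hκ
  even ξ := by rw [map_neg, symbolM_neg]
  pos := lt_min one_pos ha
  lower ξ := min_mul_le_symbolM j hb hh (κ ξ)
  upper ξ := symbolM_le j ha hb hh (κ ξ)
  memLp_weight := by
    rw [memLp_two_iff_integrable_sq (measurable_sobolevWeight _ hκ).aestronglyMeasurable]
    refine hint.congr (Eventually.of_forall fun ξ => ?_)
    simp only
    rw [sq (sobolevWeight κ (-1) ξ), sobolevWeight_mul, show (-1 : ℝ) + -1 = -2 by norm_num, sobolevWeight, neg_div,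
      div_self two_ne_zero, Real.rpow_neg_one]

omit [MeasurableSpace G] in
lemma dispersionSymbol_symbolM (j : Dispersion) (a b h : ℝ) (ξ : G) :
    dispersionSymbol κ (fun ξ => symbolM j a b h (κ ξ)) ξ = symbolA j a b h (κ ξ) := rfl

end Symbol

/-! ### The Fourier transform on `L²(ℝ)` -/

section FourierLine

/-- On `L¹ ∩ L²` the inverse Fourier transform of `L²` is given by the Fourier integral. -/
lemma coeFn_fourierInv_of_integrable (f : L2Line) (hf : Integrable f) :
    (𝓕⁻ f : L2Line) =ᵐ[volume] 𝓕⁻ (f : ℝ → ℂ) := by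
  refine ae_eq_of_integral_contDiff_smul_eq
    ((Lp.memLp _).locallyIntegrable (by norm_num)) ?_ fun φ hφ hφc => ?_
  · have : Continuous (𝓕⁻ (f : ℝ → ℂ)) := by
      rw [← Real.Lp.fourierTransformInv_toLp (memLp_one_iff_integrable.2 hf)]
      exact BoundedContinuousFunction.continuous _
    exact this.locallyIntegrable
  · have hφ₁ : HasCompactSupport (Complex.ofRealCLM ∘ φ) := hφc.comp_left rfl
    have hφ₂ := Complex.ofRealCLM.contDiff.comp hφ
    set Φ := hφ₁.toSchwartzMap hφ₂
    have h1 := congrArg (fun T : TemperedDistribution ℝ ℂ => T Φ)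
      (Lp.fourierInv_toTemperedDistribution_eq f)
    simp only [TemperedDistribution.fourierInv_apply, Lp.toTemperedDistribution_apply, SchwartzMap.fourierInv_coe] at h1
    -- The `L²` transform is characterised by duality against test functions; the multiplication
    -- formula shows that the Fourier integral satisfies the same identity.
    have h2 := VectorFourier.integral_fourierIntegral_smul_eq_flip (μ := volume) (ν := volume)
      (L := -innerₗ ℝ) Real.continuous_fourierChar (by fun_prop) Φ.integrable hf
    have hflip : (-innerₗ ℝ : ℝ →ₗ[ℝ] ℝ →ₗ[ℝ] ℝ).flip = -innerₗ ℝ := by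
      ext; simp
    rw [hflip] at h2
    exact h1.symm.trans h2

/-- The reflected complex conjugate `conj (f (-ξ))`. -/
def reflConj : L2Line →L[ℝ] L2Line :=
  (Lp.compMeasurePreservingₗᵢ ℝ (Neg.neg : ℝ → ℝ)
    (Measure.measurePreserving_neg volume)).toContinuousLinearMap.comp
      ((Complex.conjCLE : ℂ →L[ℝ] ℂ).compLpL 2 volume)

lemma coeFn_conj (f : L2Line) :
    (Complex.conjCLE : ℂ →L[ℝ] ℂ).compLpL 2 volume f =ᵐ[volume] fun x => conj (f x) :=
  (Complex.conjCLE : ℂ →L[ℝ] ℂ).coeFn_compLpL f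

lemma coeFn_reflConj (f : L2Line) : reflConj f =ᵐ[volume] fun x => conj (f (-x)) := by
  have hneg := Measure.measurePreserving_neg (volume : Measure ℝ)
  filter_upwards [Lp.coeFn_compMeasurePreserving
    ((Complex.conjCLE : ℂ →L[ℝ] ℂ).compLpL 2 volume f) hneg,
    hneg.quasiMeasurePreserving.ae (coeFn_conj f)] with x h1 h2
  exact h1.trans h2

lemma fourierInv_conj_neg (f : ℝ → ℂ) (x : ℝ) :
    𝓕⁻ (fun ξ => conj (f (-ξ))) x = conj (𝓕⁻ f x) := by
  rw [Real.fourierInv_eq', Real.fourierInv_eq', ← integral_conj, ← integral_neg_eq_self]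
  refine integral_congr_ae (Eventually.of_forall fun ξ => ?_)
  simp [← Complex.exp_conj, map_ofNat]

/-- Both sides are continuous in `f`, so Schwartz functions suffice, and for these the Fourier
integral can be conjugated directly. -/
lemma fourierInv_reflConj (f : L2Line) :
    (𝓕⁻ (reflConj f) : L2Line) = (Complex.conjCLE : ℂ →L[ℝ] ℂ).compLpL 2 volume (𝓕⁻ f) := by
  refine DenseRange.induction_on (p := fun f : L2Line => (𝓕⁻ (reflConj f) : L2Line) =
    (Complex.conjCLE : ℂ →L[ℝ] ℂ).compLpL 2 volume (𝓕⁻ f))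
    (SchwartzMap.denseRange_toLpCLM (F := ℂ) (p := 2) (μ := (volume : Measure ℝ))
      ENNReal.ofNat_ne_top) f ?_ fun φ => ?_
  · exact isClosed_eq
      ((Lp.fourierTransformₗᵢ ℝ ℂ).symm.continuous.comp reflConj.continuous)
      (((Complex.conjCLE : ℂ →L[ℝ] ℂ).compLpL 2 volume).continuous.comp
        (Lp.fourierTransformₗᵢ ℝ ℂ).symm.continuous)
  · set g : L2Line := SchwartzMap.toLpCLM ℝ ℂ 2 volume φ
    have hg : g =ᵐ[volume] φ := φ.coeFn_toLp 2 volume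
    have hgi : Integrable g := φ.integrable.congr hg.symm
    have hri : Integrable (reflConj g) := by
      have : Integrable fun x => conj (g (-x)) := by
        have := (Complex.conjCLE : ℂ →L[ℝ] ℂ).integrable_comp hgi.comp_neg
        exact this
      exact this.congr (coeFn_reflConj g).symm
    refine Lp.ext ?_
    filter_upwards [coeFn_fourierInv_of_integrable _ hri, coeFn_fourierInv_of_integrable _ hgi,
      coeFn_conj (𝓕⁻ g)] with x h1 h2 h3
    rw [h1, h3, h2, Real.fourierInv_congr_ae (coeFn_reflConj g), fourierInv_conj_neg]

/-- Conjugating `𝓕⁻ f` amounts to reflecting and conjugating `f`; injectivity of `𝓕⁻` then equates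
the fixed points. -/
lemma real_fourierInv_iff (f : L2Line) :
    (∀ᵐ x, ((𝓕⁻ f : L2Line) x).im = 0) ↔ f ∈ hermitianSubmodule volume := by
  have h1 : (∀ᵐ x, ((𝓕⁻ f : L2Line) x).im = 0) ↔
      (Complex.conjCLE : ℂ →L[ℝ] ℂ).compLpL 2 volume (𝓕⁻ f) = 𝓕⁻ f := by
    rw [Lp.ext_iff]
    constructor
    · intro h
      filter_upwards [h, coeFn_conj (𝓕⁻ f)] with x hx h2
      rw [h2, Complex.conj_eq_iff_im, hx]
    · intro h
      filter_upwards [h, coeFn_conj (𝓕⁻ f)] with x hx h2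
      rw [h2, Complex.conj_eq_iff_im] at hx
      exact hx
  have h2 : f ∈ hermitianSubmodule volume ↔ reflConj f = f := by
    rw [mem_hermitianSubmodule, Lp.ext_iff]
    constructor
    · intro h
      filter_upwards [h, coeFn_reflConj f] with x hx h2
      rw [h2, hx, Complex.conj_conj]
    · intro h
      filter_upwards [h, coeFn_reflConj f] with x hx h2
      rw [← hx, h2, Complex.conj_conj]
  rw [h1, h2, ← fourierInv_reflConj]
  exact (Lp.fourierTransformₗᵢ ℝ ℂ).symm.injective.eq_iff

lemma real_iff_fourier_mem (u : L2Line) :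
    (∀ᵐ x, (u x).im = 0) ↔ (𝓕 u : L2Line) ∈ hermitianSubmodule volume := by
  rw [← real_fourierInv_iff, FourierTransform.fourierInv_fourier_eq]

/-- The product of two functions with integrable Fourier transforms is the inverse Fourier
transform of the convolution. -/
lemma fourierInv_convolution {U V : ℝ → ℂ} (hU : Integrable U) (hV : Integrable V) (x : ℝ) :
    𝓕⁻ (U ⋆[mul ℂ ℂ, volume] V) x = 𝓕⁻ U x * 𝓕⁻ V x := by
  simp only [Real.fourierInv_eq_fourier_neg]
  exact Real.fourier_mul_convolution_eq hU hV (-x)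

end FourierLine

/-! ### The convolution of two profiles as an `L²` function -/

section ConvolutionLp

variable {G : Type*} [AddCommGroup G] [MeasurableSpace G] [MeasurableAdd₂ G] [MeasurableNeg G]
  {μ : Measure G} [SFinite μ] [μ.IsAddLeftInvariant] [μ.IsNegInvariant] {U V : G → ℂ}

lemma memLp_convolution (hUm : Measurable U) (hVm : Measurable V) (hU1 : MemLp U 1 μ)
    (hU2 : MemLp U 2 μ) (hV1 : MemLp V 1 μ) (hV2 : MemLp V 2 μ) :
    MemLp (U ⋆[mul ℂ ℂ, μ] V) 2 μ := by
  refine ⟨(measurable_convolution hUm hVm).aestronglyMeasurable, ?_⟩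
  -- With `κ = 0` and `σ = 0` the weights are `1` and the tame estimate is a plain `L²` bound.
  have h := eLpNorm_weighted_convolution_le (μ := μ) (κ := 0) (σ := 0) measurable_zero le_rfl
    hUm hVm
  simp only [weighted_zero] at h
  have := hU1.2
  have := hU2.2
  have := hV1.2
  have := hV2.2
  refine h.trans_lt ?_
  finiteness

variable {κ : G →+ ℝ} {M : G → ℝ} {c₀ c₁ s : ℝ}

namespace IsEllipticSymbol

lemma memLp_profile_convolution (h : IsEllipticSymbol μ κ M c₀ c₁) (hs : 1 ≤ s) (g : Lp ℂ 2 μ) :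
    MemLp (weighted κ (-s) g ⋆[mul ℂ ℂ, μ] weighted κ (-s) g) 2 μ := by
  have hm := measurable_weighted (-s) h.measurable_freq (Lp.stronglyMeasurable g).measurable
  have h1 := h.memLp_one_weighted hs g
  have h2 := h.memLp_weighted (τ := -s) (by linarith) g
  exact memLp_convolution hm hm h1 h2 h1 h2

/-- Removing the Bessel weight returns the equation for `û` itself, the form compared with `A_j (u -
c u²)`. -/
lemma weighted_modelField (h : IsEllipticSymbol μ κ M c₀ c₁) (hs : 1 ≤ s) (c : ℝ)
    (g : hermitianSubmodule μ) :
    weighted κ (-s) (h.modelField hs c g : Lp ℂ 2 μ) =ᵐ[μ] fun ξ => dispersionSymbol κ M ξ *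
      (weighted κ (-s) (g : Lp ℂ 2 μ) ξ - c *
        (weighted κ (-s) (g : Lp ℂ 2 μ) ⋆[mul ℂ ℂ, μ] weighted κ (-s) (g : Lp ℂ 2 μ)) ξ) := by
  have h1 := coeFn_multiplier h.memLp_dispersionSymbol (g : Lp ℂ 2 μ)
  have h2 := h.coeFn_bilinearPart hs (g : Lp ℂ 2 μ) g
  have h3 := Lp.coeFn_smul c (h.bilinearPart hs (g : Lp ℂ 2 μ) g)
  have h4 := Lp.coeFn_sub (h.linearPart g) (c • h.bilinearPart hs (g : Lp ℂ 2 μ) g)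
  filter_upwards [h1, h2, h3, h4] with ξ e1 e2 e3 e4
  have hw : (sobolevWeight κ (-s) ξ : ℂ) * sobolevWeight κ s ξ = 1 := by
    rw [← Complex.ofReal_mul, sobolevWeight_mul, neg_add_cancel, sobolevWeight_zero,
      Complex.ofReal_one]
  have e5 : (h.modelField hs c g : Lp ℂ 2 μ) ξ = dispersionSymbol κ M ξ * (g : Lp ℂ 2 μ) ξ -
      c * bilinearTerm μ κ M s (g : Lp ℂ 2 μ) (g : Lp ℂ 2 μ) ξ := by
    refine Eq.trans e4 ?_
    rw [Pi.sub_apply, e3, Pi.smul_apply, e2, Complex.real_smul]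
    congr 1
  rw [weighted, e5, bilinearTerm]
  generalize hQ : (weighted κ (-s) (g : Lp ℂ 2 μ) ⋆[mul ℂ ℂ, μ]
    weighted κ (-s) (g : Lp ℂ 2 μ)) ξ = Q
  simp only [weighted]
  rw [hQ]
  linear_combination (-c * dispersionSymbol κ M ξ * Q) * hw

end IsEllipticSymbol

end ConvolutionLp

/-! ### The nonperiodic problem -/

section Line

/-- The frequency `k = 2πξ`. -/
def lineFreq : ℝ →+ ℝ := AddMonoidHom.mulLeft (2 * Real.pi)


lemma measurable_lineFreq : Measurable lineFreq := measurable_const_mul (2 * Real.pi)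

lemma integrable_lineFreq : Integrable (fun ξ : ℝ => (1 + lineFreq ξ ^ 2)⁻¹) :=
  integrable_inv_one_add_sq.comp_mul_left' Real.two_pi_pos.ne'

variable {s : ℝ}

lemma lineWeighted_eq (s : ℝ) (f : L2Line) :
    lineWeighted s f = weighted lineFreq s (𝓕 f : L2Line) := rfl

lemma coeFn_lineBessel (u : HsLine s) :
    lineBessel s u =ᵐ[volume] weighted lineFreq s (𝓕 u.toL2 : L2Line) :=
  MemLp.coeFn_toLp (Subtype.property u).2

lemma fourier_toL2 (u : HsLine s) :
    (𝓕 u.toL2 : L2Line) =ᵐ[volume] weighted lineFreq (-s) (lineBessel s u) := by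
  filter_upwards [coeFn_lineBessel u] with ξ h
  have := congrFun (weighted_weighted lineFreq (-s) s ((𝓕 u.toL2 : L2Line) : ℝ → ℂ)) ξ
  rw [neg_add_cancel, weighted_zero] at this
  exact this.symm.trans (congrArg (_ * ·) h.symm)

lemma mem_hermitian_of_weighted {f g : L2Line} {κ : ℝ →+ ℝ} {τ : ℝ}
    (hf : f ∈ hermitianSubmodule volume) (hg : g =ᵐ[volume] weighted κ τ f) :
    g ∈ hermitianSubmodule volume := by
  rw [mem_hermitianSubmodule]
  filter_upwards [IsEllipticSymbol.weighted_hermitian (κ := κ) hf τ, hg,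
    (Measure.measurePreserving_neg (volume : Measure ℝ)).quasiMeasurePreserving.ae hg]
    with ξ h1 h2 h3
  rw [h2, h3, h1]

lemma lineBessel_mem (u : HsLine s) : lineBessel s u ∈ hermitianSubmodule volume :=
  mem_hermitian_of_weighted ((real_iff_fourier_mem _).1 (Subtype.property u).1)
    (coeFn_lineBessel u)

/-- The Bessel potential as an isometry onto the Hermitian functions. -/
def lineBesselIsometry (s : ℝ) : HsLine s →ₗᵢ[ℝ] hermitianSubmodule (volume : Measure ℝ) where
  toLinearMap := (lineBessel s).codRestrict _ lineBessel_mem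
  norm_map' _ := rfl

lemma lineBesselIsometry_surjective (hs : 0 ≤ s) :
    Function.Surjective (lineBesselIsometry s) := by
  intro g
  have hm : MemLp (weighted lineFreq (-s) (g : L2Line)) 2 volume := by
    refine (Lp.memLp (g : L2Line)).of_le (measurable_weighted _ measurable_lineFreq
      (Lp.stronglyMeasurable (g : L2Line)).measurable).aestronglyMeasurable
      (Eventually.of_forall fun ξ => ?_)
    rw [norm_weighted]
    exact mul_le_of_le_one_left (norm_nonneg _) (sobolevWeight_le_one _ ξ (by linarith))
  set f : L2Line := 𝓕⁻ (hm.toLp _ : L2Line) with hf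
  have hFf : (𝓕 f : L2Line) = hm.toLp _ := FourierTransform.fourier_fourierInv_eq _
  have hw : lineWeighted s f =ᵐ[volume] (g : L2Line) := by
    rw [lineWeighted_eq, hFf]
    filter_upwards [hm.coeFn_toLp] with ξ h
    rw [weighted, h]
    have := congrFun (weighted_weighted lineFreq s (-s) ((g : L2Line) : ℝ → ℂ)) ξ
    rwa [add_neg_cancel, weighted_zero] at this
  have hreal : ∀ᵐ x, (f x).im = 0 :=
    (real_fourierInv_iff _).2 (mem_hermitian_of_weighted g.2 hm.coeFn_toLp)
  refine ⟨⟨f, hreal, (memLp_congr_ae hw).2 (Lp.memLp _)⟩, ?_⟩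
  refine Subtype.ext (Lp.ext ?_)
  exact (coeFn_lineBessel _).trans hw

/-- `H^s(ℝ)` is isometric to the space of Hermitian functions. -/
def lineBesselEquiv (hs : 0 ≤ s) : HsLine s ≃ₗᵢ[ℝ] hermitianSubmodule (volume : Measure ℝ) :=
  LinearIsometryEquiv.ofSurjective (lineBesselIsometry s) (lineBesselIsometry_surjective hs)

lemma coe_lineBesselEquiv (hs : 0 ≤ s) (u : HsLine s) :
    (lineBesselEquiv hs u : L2Line) = lineBessel s u := rfl

lemma fourier_real_smul (c : ℝ) (f : L2Line) : (𝓕 (c • f) : L2Line) = c • 𝓕 f := by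
  have := (Lp.fourierTransformₗᵢ ℝ ℂ).map_smul (c : ℂ) f
  rwa [Complex.coe_smul, Complex.coe_smul] at this

lemma lineA_eq (j : Dispersion) {a b h : ℝ} (ha : 0 < a) (hb : 0 < b) (hh : 0 < h) {f g : L2Line}
    (hfg : (𝓕 g : L2Line) =ᵐ[volume] fun ξ => symbolA j a b h (lineFreq ξ) * (𝓕 f : L2Line) ξ) :
    g = lineA j ha hb hh f := by
  rw [lineA, ← FourierTransform.fourierInv_fourier_eq (E := L2Line) (F := L2Line) g]
  congr 1
  refine Lp.ext ?_
  filter_upwards [hfg, Lp.coeFn_lpSMul (r := 2) ((memLp_symbolA j ha hb hh).toLp _)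
    (𝓕 f : L2Line), (memLp_symbolA j ha hb hh).coeFn_toLp] with ξ h1 h2 h3
  rw [h1, h2, Pi.smul_apply', h3]
  rfl

/-- Since `û ∈ L¹`, both `u` and the inverse transform of `û * û ∈ L¹ ∩ L²` are given by Fourier
integrals, and the convolution theorem makes the latter equal to `u²` almost everywhere. -/
lemma isLineRHS_of_lineBessel (j : Dispersion) (α : ℝ) {a b h : ℝ} (ha : 0 < a) (hb : 0 < b)
    (hh : 0 < h) (hs : 1 ≤ s) {u v : HsLine s}
    (huv : lineBesselEquiv (by linarith) v =
      (isEllipticSymbol_symbolM j ha hb hh measurable_lineFreq integrable_lineFreq).modelField hs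
        (3 * α / 4) (lineBesselEquiv (by linarith) u)) :
    IsLineRHS j α ha hb hh u v := by
  set E := isEllipticSymbol_symbolM j ha hb hh measurable_lineFreq integrable_lineFreq
  have hs0 : 0 ≤ s := by linarith
  set g : L2Line := lineBessel s u
  set U := weighted lineFreq (-s) g with hUdef
  have hU1 : Integrable U := memLp_one_iff_integrable.1 (E.memLp_one_weighted hs g)
  have hQ : MemLp (U ⋆[mul ℂ ℂ, volume] U) 2 volume := E.memLp_profile_convolution hs g
  set Q : L2Line := hQ.toLp _
  have hQi : Integrable Q :=
    (Integrable.integrable_convolution (mul ℂ ℂ) hU1 hU1).congr hQ.coeFn_toLp.symm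
  have hu : (𝓕 u.toL2 : L2Line) =ᵐ[volume] U := fourier_toL2 u
  refine ⟨𝓕⁻ Q, ?_, lineA_eq j ha hb hh ?_⟩
  · have h1 := coeFn_fourierInv_of_integrable (𝓕 u.toL2 : L2Line) (hU1.congr hu.symm)
    rw [FourierTransform.fourierInv_fourier_eq] at h1
    filter_upwards [coeFn_fourierInv_of_integrable Q hQi, h1] with x e1 e2
    rw [e1, e2, Real.fourierInv_congr_ae hQ.coeFn_toLp, Real.fourierInv_congr_ae hu,
      fourierInv_convolution hU1 hU1, sq]
  · have hlin : (𝓕 (u.toL2 - (3 * α / 4) • (𝓕⁻ Q : L2Line)) : L2Line) =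
        𝓕 u.toL2 - (3 * α / 4) • Q := by
      have h1 : (𝓕 (u.toL2 - (3 * α / 4) • (𝓕⁻ Q : L2Line)) : L2Line) =
          𝓕 u.toL2 - 𝓕 ((3 * α / 4) • (𝓕⁻ Q : L2Line)) := (Lp.fourierTransformₗᵢ ℝ ℂ).map_sub _ _
      rw [h1, fourier_real_smul, FourierTransform.fourier_fourierInv_eq (E := L2Line)]
    rw [hlin]
    have hv : (lineBessel s v : L2Line) = E.modelField hs (3 * α / 4) (lineBesselEquiv hs0 u) := by
      rw [← coe_lineBesselEquiv hs0, huv]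
    have h1 := fourier_toL2 v
    rw [hv] at h1
    filter_upwards [h1, E.weighted_modelField hs (3 * α / 4) (lineBesselEquiv hs0 u), hu,
      hQ.coeFn_toLp, Lp.coeFn_sub (𝓕 u.toL2 : L2Line) ((3 * α / 4) • Q),
      Lp.coeFn_smul (3 * α / 4) Q] with ξ e1 e2 e3 e4 e5 e6
    rw [e1, e2, e5, Pi.sub_apply, e6, Pi.smul_apply, e3, e4, dispersionSymbol_symbolM,
      Complex.real_smul]
    rfl

theorem exists_lineField (j : Dispersion) (α : ℝ) {a b h : ℝ} (ha : 0 < a) (hb : 0 < b)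
    (hh : 0 < h) (hs : 1 ≤ s) : ∃ F : HsLine s → HsLine s,
      (∀ u, IsLineRHS j α ha hb hh u (F u)) ∧ Continuous F ∧
        ∀ η₀ : HsLine s, GloballyWellPosed F η₀ := by
  set E := isEllipticSymbol_symbolM j ha hb hh measurable_lineFreq integrable_lineFreq
  set Φ := lineBesselEquiv (s := s) (by linarith)
  refine ⟨fun u => Φ.symm (E.modelField hs (3 * α / 4) (Φ u)), fun u => ?_, ?_, fun η₀ => ?_⟩
  · exact isLineRHS_of_lineBessel j α ha hb hh hs (Φ.apply_symm_apply _)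
  · exact Φ.symm.continuous.comp ((E.continuous_modelField hs _).comp Φ.continuous)
  · have := (E.globallyWellPosed_modelField hs (3 * α / 4) (Φ η₀)).map Φ.symm
    simpa using this

end Line

/-! ### Square summable sequences as functions on `ℤ` with the counting measure -/

section Count

lemma integral_count_eq_tsum {f : ℤ → ℂ} (hf : Integrable f Measure.count) :
    ∫ n, f n ∂Measure.count = ∑' n, f n := by
  rw [integral_countable hf]
  simp [Measure.real]

/-- Matches the `ℓ²` norm defining `H^s_per` with the `L²` norm used in the model, so that the
Bessel map is isometric. -/
lemma eLpNorm_count_two_eq {f : ℤ → ℂ} (hf : Memℓp f 2) :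
    eLpNorm f 2 Measure.count = ‖(⟨f, hf⟩ : lp (fun _ : ℤ => ℂ) 2)‖ₑ := by
  have hsum := (memℓp_gen_iff (by norm_num)).1 hf
  simp only [ENNReal.toReal_ofNat, Real.rpow_two] at hsum
  rw [← ofReal_norm, lp.norm_eq_tsum_rpow (by norm_num),
    eLpNorm_eq_lintegral_rpow_enorm_toReal two_ne_zero ENNReal.ofNat_ne_top, lintegral_count]
  simp only [ENNReal.toReal_ofNat, Real.rpow_two, ENNReal.rpow_two]
  rw [← ENNReal.ofReal_rpow_of_nonneg (tsum_nonneg fun _ => by positivity) (by norm_num),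
    ENNReal.ofReal_tsum_of_nonneg (fun _ => by positivity) hsum]
  congr 2
  funext n
  rw [ENNReal.ofReal_pow (norm_nonneg _), ofReal_norm]

lemma memLp_count_two_iff {f : ℤ → ℂ} : MemLp f 2 Measure.count ↔ Memℓp f 2 := by
  rw [memLp_two_iff_integrable_sq_norm (measurable_of_countable f).aestronglyMeasurable,
    integrable_count_iff, memℓp_gen_iff (by norm_num)]
  simp

lemma summable_of_memLp_one {f : ℤ → ℂ} (hf : MemLp f 1 Measure.count) : Summable f :=
  (integrable_count_iff.1 (memLp_one_iff_integrable.1 hf)).of_norm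

lemma coeFn_toLp_count {f : ℤ → ℂ} (hf : MemLp f 2 Measure.count) (n : ℤ) :
    hf.toLp f n = f n :=
  Measure.ae_count_iff.1 hf.coeFn_toLp n

end Count

/-! ### Fourier series of products and of real functions -/

section FourierSeries

lemma repr_eq_fourierCoeff (f : C(AddCircle (2 * Real.pi), ℂ)) (n : ℤ) :
    fourierBasis.repr (f.toLp 2 AddCircle.haarAddCircle ℂ) n = fourierCoeff f n := by
  rw [fourierBasis_repr, fourierCoeff_toLp]

/-- The `n`-th Fourier coefficient as a continuous linear functional. -/
def fourierCoeffCLM (n : ℤ) : C(AddCircle (2 * Real.pi), ℂ) →L[ℂ] ℂ :=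
  (innerSL ℂ (fourierBasis n : L2Per)).comp
    (ContinuousMap.toLp 2 AddCircle.haarAddCircle ℂ)

lemma fourierCoeffCLM_apply (n : ℤ) (f : C(AddCircle (2 * Real.pi), ℂ)) :
    fourierCoeffCLM n f = fourierCoeff f n := by
  rw [← repr_eq_fourierCoeff, HilbertBasis.repr_apply_apply]
  rfl

/-- A function with summable Fourier coefficients is continuous. -/
lemma exists_continuous_of_summable {u : L2Per}
    (hu : Summable fun n => fourierBasis.repr u n) :
    ∃ f : C(AddCircle (2 * Real.pi), ℂ), f.toLp 2 AddCircle.haarAddCircle ℂ = u := by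
  have hs : Summable fun n : ℤ =>
      fourierBasis.repr u n • (fourier n : C(AddCircle (2 * Real.pi), ℂ)) := by
    refine Summable.of_norm ?_
    simp_rw [norm_smul, fourier_norm, mul_one]
    exact hu.norm
  refine ⟨_, ((hs.hasSum.mapL (ContinuousMap.toLp 2 AddCircle.haarAddCircle ℂ)).unique ?_)⟩
  have := fourierBasis.hasSum_repr u
  rw [coe_fourierBasis] at this
  exact this

lemma fourierCoeff_fourier_mul (m n : ℤ) (f : AddCircle (2 * Real.pi) → ℂ) :
    fourierCoeff (fun x => fourier m x * f x) n = fourierCoeff f (n - m) := by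
  unfold fourierCoeff
  congr 1
  funext x
  rw [smul_eq_mul, smul_eq_mul, ← mul_assoc, ← fourier_add]
  congr 3
  ring

/-- The Fourier series of `f` converges uniformly, hence may be multiplied by `g` and have its
`n`-th coefficient taken term by term; multiplication by the mode `m` shifts coefficients by `m`.
Nothing is needed of `g` beyond continuity. -/
lemma hasSum_fourierCoeff_mul {f g : C(AddCircle (2 * Real.pi), ℂ)}
    (hf : Summable (fourierCoeff f)) (n : ℤ) :
    HasSum (fun m => fourierCoeff f m * fourierCoeff g (n - m)) (fourierCoeff (f * g) n) := by
  have h1 := (hasSum_fourier_series_of_summable hf).mul_right g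
  have h2 := h1.mapL (fourierCoeffCLM n)
  rw [fourierCoeffCLM_apply] at h2
  convert! h2 using 2 with m
  rw [smul_mul_assoc, map_smul, fourierCoeffCLM_apply, smul_eq_mul, ← fourierCoeff_fourier_mul]
  rfl

lemma real_iff_repr (u : L2Per) : (∀ᵐ x ∂AddCircle.haarAddCircle, (u x).im = 0) ↔
    ∀ n, fourierBasis.repr u (-n) = conj (fourierBasis.repr u n) := by
  set v : L2Per := (Complex.conjCLE : ℂ →L[ℝ] ℂ).compLpL 2 AddCircle.haarAddCircle u
  have hv : v =ᵐ[AddCircle.haarAddCircle] fun x => conj (u x) :=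
    (Complex.conjCLE : ℂ →L[ℝ] ℂ).coeFn_compLpL u
  have h1 : (∀ᵐ x ∂AddCircle.haarAddCircle, (u x).im = 0) ↔ v = u := by
    rw [Lp.ext_iff]
    constructor
    · intro h
      filter_upwards [h, hv] with x hx h2
      rw [h2, Complex.conj_eq_iff_im, hx]
    · intro h
      filter_upwards [h, hv] with x hx h2
      rw [h2, Complex.conj_eq_iff_im] at hx
      exact hx
  have h2 : ∀ n, fourierBasis.repr v n = conj (fourierBasis.repr u (-n)) := by
    intro n
    rw [fourierBasis_repr, fourierBasis_repr, fourierCoeff, fourierCoeff, ← integral_conj]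
    refine integral_congr_ae ?_
    filter_upwards [hv] with x hx
    rw [hx, smul_eq_mul, smul_eq_mul, map_mul, neg_neg, fourier_neg]
  rw [h1, ← fourierBasis.repr.injective.eq_iff, lp.ext_iff, funext_iff]
  constructor
  · intro h n
    rw [← h n, h2, Complex.conj_conj]
  · intro h n
    rw [h2, h, Complex.conj_conj]

end FourierSeries

/-! ### The periodic problem -/

section Per

/-- The frequency `k ∈ ℤ`. -/
def perFreq : ℤ →+ ℝ := Int.castAddHom ℝ

lemma measurable_perFreq : Measurable perFreq := measurable_of_countable _

lemma integrable_perFreq :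
    Integrable (fun n : ℤ => (1 + perFreq n ^ 2)⁻¹) Measure.count := by
  rw [integrable_count_iff]
  -- The comparison with `1/n²` fails at `n = 0`, where that quotient is `0` by convention; a term
  -- equal to `1` at `0` repairs it.
  refine Summable.of_nonneg_of_le (fun n => by positivity) (fun n => ?_)
    ((Real.summable_one_div_int_pow (p := 2)).2 one_lt_two |>.add (summable_of_hasFiniteSupport
      (f := fun n : ℤ => if n = 0 then (1 : ℝ) else 0) ?_))
  · rcases eq_or_ne n 0 with rfl | hn
    · simp
    · have : (0 : ℝ) < (n : ℝ) ^ 2 := by positivity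
      simp only [hn, if_false, add_zero, one_div]
      rw [Real.norm_of_nonneg (by positivity)]
      exact inv_anti₀ this (le_add_of_nonneg_left zero_le_one : (n : ℝ) ^ 2 ≤ 1 + (n : ℝ) ^ 2)
  · exact (Set.finite_singleton (0 : ℤ)).subset fun n hn => by
      by_contra h
      simp_all

variable {s : ℝ}

lemma perWeighted_eq (s : ℝ) (f : L2Per) :
    perWeighted s f = weighted perFreq s (fourierBasis.repr f : ℤ → ℂ) := rfl

lemma memLp_perWeighted (u : HsPer s) : MemLp (perWeighted s u.toL2) 2 Measure.count :=
  memLp_count_two_iff.2 (Subtype.property u).2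

lemma repr_toL2 (u : HsPer s) :
    (fourierBasis.repr u.toL2 : ℤ → ℂ) = weighted perFreq (-s) (perWeighted s u.toL2) := by
  rw [perWeighted_eq, weighted_weighted, neg_add_cancel, weighted_zero]

lemma toLp_perWeighted_mem (u : HsPer s) :
    (memLp_perWeighted u).toLp _ ∈ hermitianSubmodule (Measure.count : Measure ℤ) := by
  rw [mem_hermitianSubmodule, Measure.ae_count_iff]
  intro n
  rw [coeFn_toLp_count, coeFn_toLp_count, perWeighted_eq, weighted, weighted,
    (real_iff_repr u.toL2).1 (Subtype.property u).1, sobolevWeight_neg_apply, map_mul,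
    Complex.conj_ofReal]

/-- The Bessel potential as an isometry into the Hermitian sequences. -/
def perBesselIsometry (s : ℝ) : HsPer s →ₗᵢ[ℝ] hermitianSubmodule (Measure.count : Measure ℤ) where
  toFun u := ⟨(memLp_perWeighted u).toLp _, toLp_perWeighted_mem u⟩
  map_add' u v := Subtype.ext <| (MemLp.toLp_congr (memLp_perWeighted (u + v))
      ((memLp_perWeighted u).add (memLp_perWeighted v)) (Eventually.of_forall fun n =>
        congrArg (fun w : lp (fun _ : ℤ => ℂ) 2 => w n) ((perBessel s).map_add u v))).trans
    (MemLp.toLp_add (memLp_perWeighted u) (memLp_perWeighted v))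
  map_smul' c u := Subtype.ext <| (MemLp.toLp_congr (memLp_perWeighted (c • u))
      ((memLp_perWeighted u).const_smul c) (Eventually.of_forall fun n =>
        congrArg (fun w : lp (fun _ : ℤ => ℂ) 2 => w n) ((perBessel s).map_smul c u))).trans
    (MemLp.toLp_const_smul c (memLp_perWeighted u))
  norm_map' u := by
    change ‖(memLp_perWeighted u).toLp _‖ = ‖perBessel s u‖
    rw [Lp.norm_toLp]
    exact (congrArg ENNReal.toReal (eLpNorm_count_two_eq (Subtype.property u).2)).trans
      (toReal_enorm _)

lemma perBesselIsometry_apply (u : HsPer s) (n : ℤ) :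
    (perBesselIsometry s u : Lp ℂ 2 (Measure.count : Measure ℤ)) n = perWeighted s u.toL2 n :=
  coeFn_toLp_count (memLp_perWeighted u) n

lemma perBesselIsometry_surjective (hs : 0 ≤ s) :
    Function.Surjective (perBesselIsometry s) := by
  intro g
  set g' : Lp ℂ 2 (Measure.count : Measure ℤ) := g.1
  have hm : MemLp (weighted perFreq (-s) g') 2 Measure.count := by
    refine (Lp.memLp g').of_le (measurable_of_countable _).aestronglyMeasurable
      (Eventually.of_forall fun ξ => ?_)
    rw [norm_weighted]
    exact mul_le_of_le_one_left (norm_nonneg _) (sobolevWeight_le_one _ ξ (by linarith))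
  set f : L2Per := fourierBasis.repr.symm ⟨_, memLp_count_two_iff.1 hm⟩ with hf
  have hFf : (fourierBasis.repr f : ℤ → ℂ) = weighted perFreq (-s) g' := by
    rw [hf, LinearIsometryEquiv.apply_symm_apply]
  have hw : perWeighted s f = g' := by
    rw [perWeighted_eq, hFf, weighted_weighted, add_neg_cancel, weighted_zero]
  have hreal : ∀ᵐ x ∂AddCircle.haarAddCircle, (f x).im = 0 := by
    rw [real_iff_repr, hFf]
    exact Measure.ae_count_iff.1 (IsEllipticSymbol.weighted_hermitian g.2 (-s))
  refine ⟨⟨f, hreal, ?_⟩, Subtype.ext (Lp.ext (Eventually.of_forall fun n => ?_))⟩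
  · rw [hw]
    exact memLp_count_two_iff.1 (Lp.memLp _)
  · exact (perBesselIsometry_apply _ n).trans (congrFun hw n)

/-- `H^s_per` is isometric to the space of Hermitian sequences. -/
def perBesselEquiv (hs : 0 ≤ s) :
    HsPer s ≃ₗᵢ[ℝ] hermitianSubmodule (Measure.count : Measure ℤ) :=
  LinearIsometryEquiv.ofSurjective (perBesselIsometry s) (perBesselIsometry_surjective hs)

lemma coeFn_perBesselEquiv (hs : 0 ≤ s) (u : HsPer s) :
    ((perBesselEquiv hs u : Lp ℂ 2 (Measure.count : Measure ℤ)) : ℤ → ℂ) =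
      perWeighted s u.toL2 :=
  funext (perBesselIsometry_apply u)

lemma repr_real_smul (c : ℝ) (f : L2Per) :
    fourierBasis.repr (c • f) = (c : ℂ) • fourierBasis.repr f := by
  rw [← map_smul]
  rfl

/-- Summable coefficients give `u` a continuous representative `f`, so `u²` can be taken to be `f *
f`, whose coefficients are the discrete convolution. Almost everywhere identities for the counting
measure hold at every `n`. -/
lemma isPerRHS_of_perBessel (j : Dispersion) (α : ℝ) {a b h : ℝ} (ha : 0 < a) (hb : 0 < b)
    (hh : 0 < h) (hs : 1 ≤ s) {u v : HsPer s}
    (huv : perBesselEquiv (by linarith) v =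
      (isEllipticSymbol_symbolM j ha hb hh measurable_perFreq integrable_perFreq).modelField hs
        (3 * α / 4) (perBesselEquiv (by linarith) u)) :
    IsPerRHS j α ha hb hh u v := by
  set E := isEllipticSymbol_symbolM j ha hb hh measurable_perFreq integrable_perFreq
  have hs0 : 0 ≤ s := by linarith
  set g := perBesselEquiv hs0 u
  have hg : (fourierBasis.repr u.toL2 : ℤ → ℂ) =
      weighted perFreq (-s) (g : Lp ℂ 2 (Measure.count : Measure ℤ)) := by
    rw [repr_toL2, coeFn_perBesselEquiv]
  have hU2 : MemLp (fourierBasis.repr u.toL2 : ℤ → ℂ) 2 Measure.count :=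
    memLp_count_two_iff.2 (lp.memℓp _)
  have hU1 : Summable fun n => fourierBasis.repr u.toL2 n := by
    rw [hg]; exact summable_of_memLp_one (E.memLp_one_weighted hs _)
  obtain ⟨f, hf⟩ := exists_continuous_of_summable hU1
  have hfc : fourierCoeff f = (fourierBasis.repr u.toL2 : ℤ → ℂ) := by
    funext n
    rw [← hf, repr_eq_fourierCoeff]
  set q : L2Per := (f * f).toLp 2 AddCircle.haarAddCircle ℂ
  have hq : ∀ n, fourierBasis.repr q n = ((fourierBasis.repr u.toL2 : ℤ → ℂ)
      ⋆[mul ℂ ℂ, Measure.count] (fourierBasis.repr u.toL2 : ℤ → ℂ)) n := by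
    intro n
    have h1 : Summable (fourierCoeff f) := by rw [hfc]; exact hU1
    rw [repr_eq_fourierCoeff, ← (hasSum_fourierCoeff_mul h1 n).tsum_eq, hfc]
    exact (integral_count_eq_tsum (integrable_mul_sub hU2 hU2 n)).symm
  refine ⟨q, ?_, ?_⟩
  · have h1 := ContinuousMap.coeFn_toLp (p := 2) (𝕜 := ℂ)
      (AddCircle.haarAddCircle : Measure (AddCircle (2 * Real.pi))) f
    rw [hf] at h1
    filter_upwards [h1, ContinuousMap.coeFn_toLp (p := 2) (𝕜 := ℂ)
      (AddCircle.haarAddCircle : Measure (AddCircle (2 * Real.pi))) (f * f)] with x e1 e2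
    rw [e2, e1, ContinuousMap.mul_apply, sq]
  · rw [perA, LinearIsometryEquiv.eq_symm_apply]
    ext n
    have hv : (fourierBasis.repr v.toL2 : ℤ → ℂ) n = weighted perFreq (-s)
        (E.modelField hs (3 * α / 4) g : Lp ℂ 2 (Measure.count : Measure ℤ)) n := by
      rw [repr_toL2, ← coeFn_perBesselEquiv hs0, huv]
    have hsub : fourierBasis.repr (u.toL2 - (3 * α / 4) • q) n =
        fourierBasis.repr u.toL2 n - ((3 * α / 4 : ℝ) : ℂ) * fourierBasis.repr q n := by
      rw [map_sub, repr_real_smul]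
      rfl
    refine hv.trans ((Measure.ae_count_iff.1 (E.weighted_modelField hs (3 * α / 4) g) n).trans ?_)
    rw [← hg]
    exact congrArg (symbolA j a b h n * ·) (hsub.trans (by rw [hq])).symm

theorem exists_perField (j : Dispersion) (α : ℝ) {a b h : ℝ} (ha : 0 < a) (hb : 0 < b)
    (hh : 0 < h) (hs : 1 ≤ s) : ∃ F : HsPer s → HsPer s,
      (∀ u, IsPerRHS j α ha hb hh u (F u)) ∧ Continuous F ∧
        ∀ η₀ : HsPer s, GloballyWellPosed F η₀ := by
  set E := isEllipticSymbol_symbolM j ha hb hh measurable_perFreq integrable_perFreq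
  set Φ := perBesselEquiv (s := s) (by linarith)
  refine ⟨fun u => Φ.symm (E.modelField hs (3 * α / 4) (Φ u)), fun u => ?_, ?_, fun η₀ => ?_⟩
  · exact isPerRHS_of_perBessel j α ha hb hh hs (Φ.apply_symm_apply _)
  · exact Φ.symm.continuous.comp ((E.continuous_modelField hs _).comp Φ.continuous)
  · have := (E.globallyWellPosed_modelField hs (3 * α / 4) (Φ η₀)).map Φ.symm
    simpa using this

end Per

end RegBenjamin

end

theorem mainTheorem2 (j : RegBenjamin.Dispersion) (α a b h : ℝ) (hα : 0 < α) (ha : 0 < a)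
    (hb : 0 < b) (hh : 0 < h) (s : ℝ) (hs : 1 ≤ s) :
    (∃ F : RegBenjamin.HsLine s → RegBenjamin.HsLine s,
      (∀ u, RegBenjamin.IsLineRHS j α ha hb hh u (F u)) ∧ Continuous F ∧
        ∀ η₀ : RegBenjamin.HsLine s, RegBenjamin.GloballyWellPosed F η₀) ∧
    (∃ F : RegBenjamin.HsPer s → RegBenjamin.HsPer s,
      (∀ u, RegBenjamin.IsPerRHS j α ha hb hh u (F u)) ∧ Continuous F ∧
        ∀ η₀ : RegBenjamin.HsPer s, RegBenjamin.GloballyWellPosed F η₀) := by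
  exact ⟨RegBenjamin.exists_lineField j α ha hb hh hs, RegBenjamin.exists_perField j α ha hb hh hs⟩
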